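/- Let $\lambda>0$ and let $d\mu(t)=\sinh^{2\lambda}t\,dt$ on $[0,\infty)$. Functions $f$ on $[1,\infty)$ are read through $t\mapsto f(\cosh t)$, $t\ge 0$; for $1\le p<\infty$, $L_{p,\lambda}[0,\infty)$ is the space of measurable $f$ with $$\|f\|_{L_{p,\lambda}}=\Big(\int_0^\infty |f(\cosh t)|^p\,d\mu(t)\Big)^{1/p}<\infty .$$ For $t,x\ge 0$ the generalized shift is $$A^{\lambda}_{\cosh t}f(\cosh x)=\frac{\Gamma(\lambda+\frac12)}{\Gamma(\frac12)\Gamma(\lambda)}\int_0^{\pi} f(\cosh x\cosh t-\sinh x\sinh t\cos\varphi)\,(\sin\varphi)^{2\lambda-1}\,d\varphi ,$$ and the modified Riesz–Gegenbauer fractional integral of $f$ is $$\widetilde{\mathfrak I}^{\alpha}_{G}f(\cosh x)=\int_0^\infty\Big(A^{\lambda}_{\cosh t}(\sinh x)^{\alpha-2\lambda-1}-(\sinh t)^{\alpha-2\lambda-1}\chi_{(1/4,\infty)}(t)\Big)f(\cosh t)\,d\mu(t),$$ where the shift acts on the function $\cosh x\mapsto(\sinh x)^{\alpha-2\lambda-1}$.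 With $H(0,r)=[0,r)$, the Gegenbauer space $BMO[0,\infty)$ consists of the $F$ locally integrable on $[0,\infty)$ with respect to $\mu$ with $$\|F\|_{BMO}=\sup_{x\ge 0,\ r>0}\frac1{\mu(H(0,r))}\int_{H(0,r)}\big|A^{\lambda}_{\cosh t}F(\cosh x)-F_{H(0,r)}(\cosh x)\big|\,d\mu(t)<\infty,$$ $$F_{H(0,r)}(\cosh x)=\frac1{\mu(H(0,r))}\int_{H(0,r)}A^{\lambda}_{\cosh t}F(\cosh x)\,d\mu(t).$$ **Theorem.** Let $0<\alpha<2\lambda+1$ and $p\alpha=2\lambda+1$. There is a constant $c_{\alpha,\lambda,p}>0$, depending only on $\alpha,\lambda,p$, such that for every (complex-valued) $f\in L_{p,\lambda}[0,\infty)$ the integral defining $\widetilde{\mathfrak I}^{\alpha}_{G}f(\cosh x)$ converges absolutely for almost every $x\ge 0$, $\widetilde{\mathfrak I}^{\alpha}_{G}f\in BMO[0,\infty)$, and $$\big\|\widetilde{\mathfrak I}^{\alpha}_{G}f\big\|_{BMO}\le c_{\alpha,\lambda,p}\,\|f\|_{L_{p,\lambda}} .$$ -/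

import Mathlib

open MeasureTheory Set

noncomputable section

/-- The measure `dμ(t) = sinh^{2λ} t dt` on the half-line `[0, ∞)`, as a measure on `ℝ`. -/
def gegenbauerMeasure (lam : ℝ) : Measure ℝ :=
  (volume.restrict (Ici (0 : ℝ))).withDensity
    (fun t => ENNReal.ofReal (Real.sinh t ^ (2 * lam)))

/-- The interval `H(x, r) = (x - r, x + r) ∩ [0, ∞)`. -/
def gegenbauerInterval (x r : ℝ) : Set ℝ :=
  Ioo (x - r) (x + r) ∩ Ici 0

/-- The generalized shift `A_u^λ f (v)`, for `u, v ≥ 1`, of a function `f` on `[1, ∞)`.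
With `u = cosh t`, `v = cosh x` and `t, x ≥ 0` it is the integral in
`gegenbauerShift_cosh` below. -/
def gegenbauerShift {E : Type*} [NormedAddCommGroup E] [NormedSpace ℝ E]
    (lam u : ℝ) (f : ℝ → E) (v : ℝ) : E :=
  (Real.Gamma (lam + 1 / 2) / (Real.Gamma (1 / 2) * Real.Gamma lam)) •
    ∫ φ in (0 : ℝ)..Real.pi,
      (Real.sin φ ^ (2 * lam - 1)) •
        f (v * u - √(v ^ 2 - 1) * √(u ^ 2 - 1) * Real.cos φ)

theorem sqrt_cosh_sq_sub_one {t : ℝ} (ht : 0 ≤ t) :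
    √(Real.cosh t ^ 2 - 1) = Real.sinh t := by
  rw [Real.cosh_sq, add_sub_cancel_right, Real.sqrt_sq (Real.sinh_nonneg_iff.2 ht)]

theorem gegenbauerShift_cosh {E : Type*} [NormedAddCommGroup E] [NormedSpace ℝ E]
    (lam : ℝ) (f : ℝ → E) {t x : ℝ} (ht : 0 ≤ t) (hx : 0 ≤ x) :
    gegenbauerShift lam (Real.cosh t) f (Real.cosh x) =
      (Real.Gamma (lam + 1 / 2) / (Real.Gamma (1 / 2) * Real.Gamma lam)) •
        ∫ φ in (0 : ℝ)..Real.pi,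
          (Real.sin φ ^ (2 * lam - 1)) •
            f (Real.cosh x * Real.cosh t - Real.sinh x * Real.sinh t * Real.cos φ) := by
  simp only [gegenbauerShift, sqrt_cosh_sq_sub_one ht, sqrt_cosh_sq_sub_one hx]

/-- The kernel `(sinh x)^{α - 2λ - 1}`, as a function of `y = cosh x ≥ 1`. -/
def rieszGegenbauerKernel (lam α y : ℝ) : ℝ :=
  √(y ^ 2 - 1) ^ (α - 2 * lam - 1)

/-- The integrand of the modified fractional integral at the point `y = cosh x`:
`(A_{cosh t}^λ (sinh x)^{α-2λ-1} - (sinh t)^{α-2λ-1} χ_{(1/4,∞)}(t)) f(cosh t)`. -/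
def modifiedRieszGegenbauerIntegrand (lam α : ℝ) (f : ℝ → ℂ) (y t : ℝ) : ℂ :=
  (gegenbauerShift lam (Real.cosh t) (rieszGegenbauerKernel lam α) y -
      (Ioi (1 / 4 : ℝ)).indicator (fun s => Real.sinh s ^ (α - 2 * lam - 1)) t) •
    f (Real.cosh t)

/-- The modified Riesz-Gegenbauer fractional integral of `f`, as a function of
`y = cosh x ≥ 1`. -/
def modifiedRieszGegenbauer (lam α : ℝ) (f : ℝ → ℂ) (y : ℝ) : ℂ :=
  ∫ t, modifiedRieszGegenbauerIntegrand lam α f y t ∂(gegenbauerMeasure lam)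

/-- The mean `f_{H(0,r)}(cosh x)` of `t ↦ A_{cosh t}^λ f (cosh x)` over `H(0, r)`. -/
def gegenbauerMean (lam : ℝ) (f : ℝ → ℂ) (x r : ℝ) : ℂ :=
  ⨍ t in gegenbauerInterval 0 r,
    gegenbauerShift lam (Real.cosh t) f (Real.cosh x) ∂(gegenbauerMeasure lam)

/-- The Gegenbauer BMO norm, with values in `[0, ∞]`. -/
def gegenbauerBMONorm (lam : ℝ) (f : ℝ → ℂ) : ENNReal :=
  ⨆ (x : ℝ) (_ : 0 ≤ x) (r : ℝ) (_ : 0 < r),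
    (gegenbauerMeasure lam (gegenbauerInterval 0 r))⁻¹ *
      ∫⁻ t in gegenbauerInterval 0 r,
        ‖gegenbauerShift lam (Real.cosh t) f (Real.cosh x) - gegenbauerMean lam f x r‖ₑ
          ∂(gegenbauerMeasure lam)

/-- Membership of `f` (a function on `[1, ∞)`, read through `t ↦ f (cosh t)`) in the
Gegenbauer BMO space: local integrability on `[0, ∞)` and finite BMO norm. -/
def MemGegenbauerBMO (lam : ℝ) (f : ℝ → ℂ) : Prop :=
  LocallyIntegrableOn (fun t => f (Real.cosh t)) (Ici 0) (gegenbauerMeasure lam) ∧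
    gegenbauerBMONorm lam f < ⊤

end

/-! The model is hyperbolic geometry in "dimension" 2λ+1. There μ is the radial measure, and by the
law of cosines `shiftPoint` is the cosh of the distance between two points at distances x and t from
the origin, seen under the angle φ. The counterpart of translation invariance is
`lintegral_lintegral_shiftPoint`: in the coordinates (sinh t cos φ, sinh t sin φ) = (w, y) the shift
by x reads off the time coordinate of a Lorentz boost, and boosts preserve dw/√(1+y²+w²). Hölder
(`shiftConv_le`) and Young (`lintegral_shiftConv_rpow_le`) follow for the associated convolution.

Put β = 2λ+1-α and let q be conjugate to p, so that pα = 2λ+1 becomes βq = 2λ+1. Then sinh^{-βq}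
sinh^{2λ} = sinh^{-1}: the kernel sinh^{-β} is q-integrable at infinity and misses L^q only
logarithmically at 0. For a ball of radius d the kernel is truncated at scale R = min(d, 1).

The part cut off has L¹ norm at most sinh^α R / α. Young, then Hölder on the ball, bound the mean of
its shifted convolution with |f| by ‖f‖_p, because sinh^α R is controlled by μ(H(0,d))^{1/p}
(`setLIntegral_shiftConv_kernelGap_le`).

The truncated part varies little: moving its centre by at most d changes it by at most a multiple of
`kernelMajorant`, whose L^q norm is bounded uniformly in R ≤ 1 (`lintegral_kernelMajorant_rpow_le`).
For d > 1 no cancellation is needed, since the kernel truncated at scale 1 already lies in L^q. The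
subtracted indicator term cancels in all differences.

Hence within distance d of x the fractional integral stays close, on average, to one constant, and
oscillation about the mean is at most twice that about any constant
(`lintegral_enorm_sub_average_le`). -/

/-! ### The shift as an integral against an angular measure -/

/-- The measure `(sin φ)^{2λ-1} dφ` on `(0, π]`. -/
noncomputable def angleMeasure (lam : ℝ) : Measure ℝ :=
  (volume.restrict (Ioc 0 Real.pi)).withDensity
    (fun φ => ENNReal.ofReal (Real.sin φ ^ (2 * lam - 1)))

/-- The point at which the generalized shift evaluates its argument. -/
noncomputable def shiftPoint (v u φ : ℝ) : ℝ :=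
  v * u - √(v ^ 2 - 1) * √(u ^ 2 - 1) * Real.cos φ

theorem shiftPoint_comm (v u φ : ℝ) : shiftPoint v u φ = shiftPoint u v φ := by
  unfold shiftPoint; ring

theorem measurable_shiftPoint_right (v : ℝ) :
    Measurable fun z : ℝ × ℝ => shiftPoint v (Real.cosh z.1) z.2 := by
  unfold shiftPoint; fun_prop

theorem measurable_shiftPoint_angle (v u : ℝ) : Measurable fun φ => shiftPoint v u φ := by
  unfold shiftPoint; fun_prop

theorem shiftPoint_cosh {x t : ℝ} (hx : 0 ≤ x) (ht : 0 ≤ t) (φ : ℝ) :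
    shiftPoint (Real.cosh x) (Real.cosh t) φ =
      Real.cosh x * Real.cosh t - Real.sinh x * Real.sinh t * Real.cos φ := by
  simp only [shiftPoint, sqrt_cosh_sq_sub_one ht, sqrt_cosh_sq_sub_one hx]

theorem measurable_sinh_rpow (r : ℝ) :
    Measurable fun t => ENNReal.ofReal (Real.sinh t ^ r) := by
  fun_prop

theorem measurable_sin_rpow (r : ℝ) :
    Measurable fun t => ENNReal.ofReal (Real.sin t ^ r) := by
  fun_prop

instance sFinite_angleMeasure (lam : ℝ) : SFinite (angleMeasure lam) := by
  unfold angleMeasure; infer_instance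

instance sFinite_gegenbauerMeasure (lam : ℝ) : SFinite (gegenbauerMeasure lam) := by
  unfold gegenbauerMeasure; infer_instance

/-- Jordan's inequality at each end of (0, π). It serves the case λ < 1/2, in which the angular
weight is singular at both ends. -/
theorem sin_rpow_le {r φ : ℝ} (hr : r < 0) (h0 : 0 < φ) (h1 : φ < Real.pi) :
    Real.sin φ ^ r ≤ (2 / Real.pi) ^ r * (φ ^ r + (Real.pi - φ) ^ r) := by
  have hpi := Real.pi_pos
  have key : ∀ ψ : ℝ, 0 < ψ → ψ ≤ Real.pi / 2 →
      Real.sin ψ ^ r ≤ (2 / Real.pi) ^ r * ψ ^ r := by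
    intro ψ h h'
    rw [← Real.mul_rpow (by positivity) h.le]
    exact Real.rpow_le_rpow_of_nonpos (by positivity) (Real.mul_le_sin h.le h') hr.le
  have hφ : 0 ≤ φ ^ r := Real.rpow_nonneg h0.le _
  have hφ' : 0 ≤ (Real.pi - φ) ^ r := Real.rpow_nonneg (by linarith) _
  have hc : 0 ≤ (2 / Real.pi) ^ r := Real.rpow_nonneg (by positivity) _
  rcases le_total φ (Real.pi / 2) with h | h
  · exact (key φ h0 h).trans (mul_le_mul_of_nonneg_left (by linarith) hc)
  · have := key (Real.pi - φ) (by linarith) (by linarith)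
    rw [Real.sin_pi_sub] at this
    exact this.trans (mul_le_mul_of_nonneg_left (by linarith) hc)

theorem integrableOn_sin_rpow {r : ℝ} (hr : -1 < r) :
    IntegrableOn (fun φ => Real.sin φ ^ r) (Ioc 0 Real.pi) := by
  have hpi := Real.pi_pos
  rw [integrableOn_Ioc_iff_integrableOn_Ioo]
  rcases lt_or_ge r 0 with h | h
  · have h1 : IntervalIntegrable (fun φ : ℝ => φ ^ r) volume 0 Real.pi :=
      intervalIntegral.intervalIntegrable_rpow' hr
    have h2 : IntervalIntegrable (fun φ : ℝ => (Real.pi - φ) ^ r) volume 0 Real.pi := by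
      have := (h1.comp_sub_left Real.pi).symm
      simpa using this
    have h3 := ((h1.add h2).const_mul ((2 / Real.pi) ^ r)).1
    rw [integrableOn_Ioc_iff_integrableOn_Ioo] at h3
    refine Integrable.mono' h3
      (Real.measurable_sin.pow_const r).aestronglyMeasurable ?_
    filter_upwards [ae_restrict_mem measurableSet_Ioo] with φ hφ
    rw [Real.norm_of_nonneg (Real.rpow_nonneg (Real.sin_nonneg_of_mem_Icc ⟨hφ.1.le, hφ.2.le⟩) _)]
    exact sin_rpow_le h hφ.1 hφ.2
  · refine Integrable.mono' (g := fun _ => (1 : ℝ)) (by simp) (by fun_prop) ?_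
    filter_upwards [ae_restrict_mem measurableSet_Ioo] with φ hφ
    have h0 := Real.sin_nonneg_of_mem_Icc ⟨hφ.1.le, hφ.2.le⟩
    rw [Real.norm_of_nonneg (Real.rpow_nonneg h0 _)]
    exact Real.rpow_le_one h0 (Real.sin_le_one _) h

theorem isFiniteMeasure_angleMeasure {lam : ℝ} (hlam : 0 < lam) :
    IsFiniteMeasure (angleMeasure lam) :=
  isFiniteMeasure_withDensity_ofReal (integrableOn_sin_rpow (by linarith)).2

theorem gegenbauerShift_eq {E : Type*} [NormedAddCommGroup E] [NormedSpace ℝ E]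
    (lam u : ℝ) (f : ℝ → E) (v : ℝ) :
    gegenbauerShift lam u f v =
      (Real.Gamma (lam + 1 / 2) / (Real.Gamma (1 / 2) * Real.Gamma lam)) •
        ∫ φ, f (shiftPoint v u φ) ∂(angleMeasure lam) := by
  unfold gegenbauerShift angleMeasure
  congr 1
  rw [intervalIntegral.integral_of_le Real.pi_pos.le,
    integral_withDensity_eq_integral_toReal_smul (measurable_sin_rpow _) (by simp)]
  refine setIntegral_congr_fun measurableSet_Ioc fun φ hφ => ?_
  simp only [shiftPoint]
  rw [ENNReal.toReal_ofReal]
  exact Real.rpow_nonneg (Real.sin_nonneg_of_mem_Icc ⟨hφ.1.le, hφ.2⟩) _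

/-! ### Invariance of the measure under the shift -/

theorem lintegral_sinh_image {s : Set ℝ} (hs : MeasurableSet s) (G : ℝ → ENNReal) :
    ∫⁻ u in Real.sinh '' s, G u = ∫⁻ t in s, ENNReal.ofReal (Real.cosh t) * G (Real.sinh t) := by
  rw [lintegral_image_eq_lintegral_abs_deriv_mul hs
    (fun x _ => (Real.hasDerivAt_sinh x).hasDerivWithinAt) Real.sinh_injective.injOn]
  simp only [abs_of_pos (Real.cosh_pos _)]

theorem sinh_image_Ioi (a : ℝ) : Real.sinh '' Ioi a = Ioi (Real.sinh a) :=
  Real.sinhOrderIso.image_Ioi a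

theorem sinh_image_Ioo (a b : ℝ) : Real.sinh '' Ioo a b = Ioo (Real.sinh a) (Real.sinh b) :=
  Real.sinhOrderIso.image_Ioo a b

theorem lintegral_gegenbauerMeasure (lam : ℝ) {g : ℝ → ENNReal} (hg : Measurable g) :
    ∫⁻ t, g t ∂(gegenbauerMeasure lam) =
      ∫⁻ t in Ioi 0, ENNReal.ofReal (Real.sinh t ^ (2 * lam)) * g t := by
  unfold gegenbauerMeasure
  rw [lintegral_withDensity_eq_lintegral_mul _ (measurable_sinh_rpow _) hg,
    restrict_Ioi_eq_restrict_Ici]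
  rfl

theorem lintegral_angleMeasure (lam : ℝ) {g : ℝ → ENNReal} (hg : Measurable g) :
    ∫⁻ t, g t ∂(angleMeasure lam) =
      ∫⁻ t in Ioo 0 Real.pi, ENNReal.ofReal (Real.sin t ^ (2 * lam - 1)) * g t := by
  unfold angleMeasure
  rw [lintegral_withDensity_eq_lintegral_mul _ (measurable_sin_rpow _) hg,
    restrict_Ioo_eq_restrict_Ioc]
  rfl

theorem ae_gegenbauerMeasure_pos (lam : ℝ) : ∀ᵐ t ∂(gegenbauerMeasure lam), 0 < t := by
  unfold gegenbauerMeasure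
  refine (withDensity_absolutelyContinuous _ _).ae_le ?_
  rw [← restrict_Ioi_eq_restrict_Ici]
  exact ae_restrict_mem measurableSet_Ioi

theorem ae_gegenbauerMeasure_ne (lam a : ℝ) : ∀ᵐ t ∂(gegenbauerMeasure lam), t ≠ a := by
  unfold gegenbauerMeasure
  refine (withDensity_absolutelyContinuous _ _).ae_le (ae_restrict_of_ae ?_)
  simp [ae_iff]

/-- The density, on the upper half-plane, of `g` against the measure that the shift transports. -/
noncomputable def halfPlaneDensity (lam : ℝ) (g : ℝ → ENNReal) (x : ℝ) (z : ℝ × ℝ) : ENNReal :=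
  (Ioi (0 : ℝ)).indicator (fun _ => ENNReal.ofReal (z.2 ^ (2 * lam - 1)) *
    (ENNReal.ofReal (1 / √(1 + z.2 ^ 2 + z.1 ^ 2)) *
      g (√(1 + z.2 ^ 2 + z.1 ^ 2) * Real.cosh x - z.1 * Real.sinh x))) z.2

theorem measurable_halfPlaneDensity (lam : ℝ) {g : ℝ → ENNReal} (hg : Measurable g) (x : ℝ) :
    Measurable (halfPlaneDensity lam g x) := by
  have h : halfPlaneDensity lam g x = (Prod.snd ⁻¹' Ioi (0 : ℝ)).indicator
      (fun z => ENNReal.ofReal (z.2 ^ (2 * lam - 1)) *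
    (ENNReal.ofReal (1 / √(1 + z.2 ^ 2 + z.1 ^ 2)) *
      g (√(1 + z.2 ^ 2 + z.1 ^ 2) * Real.cosh x - z.1 * Real.sinh x))) := by
    funext z
    simp only [halfPlaneDensity, indicator, mem_preimage]
  rw [h]
  exact Measurable.indicator (by fun_prop) (measurable_snd measurableSet_Ioi)

/-- Integrating along a horizontal line amounts to integrating a translate. -/
theorem lintegral_horizontal (g : ℝ → ENNReal) (x y : ℝ) :
    ∫⁻ w, ENNReal.ofReal (1 / √(1 + y ^ 2 + w ^ 2)) *
      g (√(1 + y ^ 2 + w ^ 2) * Real.cosh x - w * Real.sinh x) =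
    ∫⁻ τ, g (√(1 + y ^ 2) * Real.cosh τ) := by
  set b := √(1 + y ^ 2) with hb
  have hb0 : 0 < b := Real.sqrt_pos.2 (by positivity)
  have hb2 : b ^ 2 = 1 + y ^ 2 := Real.sq_sqrt (by positivity)
  have hsq : ∀ τ, √(1 + y ^ 2 + (b * Real.sinh τ) ^ 2) = b * Real.cosh τ := by
    intro τ
    rw [← hb2, show b ^ 2 + (b * Real.sinh τ) ^ 2 = (b * Real.cosh τ) ^ 2 by
      rw [mul_pow, mul_pow, Real.cosh_sq]; ring]
    exact Real.sqrt_sq (mul_nonneg hb0.le (Real.cosh_pos τ).le)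
  have himg : (fun τ => b * Real.sinh τ) '' univ = univ := by
    rw [image_univ]
    refine (Function.Surjective.range_eq fun w => ?_)
    obtain ⟨τ, hτ⟩ := Real.sinh_surjective (w / b)
    exact ⟨τ, by simp only [hτ]; field_simp⟩
  have hinj : InjOn (fun τ => b * Real.sinh τ) univ := fun s _ t _ h =>
    Real.sinh_injective (mul_left_cancel₀ hb0.ne' h)
  rw [← setLIntegral_univ, ← himg, lintegral_image_eq_lintegral_abs_deriv_mul MeasurableSet.univ
    (fun τ _ => ((Real.hasDerivAt_sinh τ).const_mul b).hasDerivWithinAt) hinj, setLIntegral_univ]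
  -- After w = b sinh τ the argument of g is b cosh(τ - x), and the Jacobian b cosh τ cancels the
  -- weight; translation invariance then removes x.
  rw [← lintegral_sub_right_eq_self (fun τ => g (b * Real.cosh τ)) x]
  refine lintegral_congr fun τ => ?_
  have hp : 0 < b * Real.cosh τ := mul_pos hb0 (Real.cosh_pos τ)
  rw [hsq, abs_of_pos hp, ← mul_assoc, ← ENNReal.ofReal_mul hp.le, mul_one_div_cancel hp.ne',
    ENNReal.ofReal_one, one_mul, Real.cosh_sub]
  congr 1; ring

theorem lintegral_halfPlaneDensity (lam : ℝ) {g : ℝ → ENNReal} (hg : Measurable g) (x : ℝ) :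
    ∫⁻ z, halfPlaneDensity lam g x z =
      ∫⁻ y in Ioi (0 : ℝ), ENNReal.ofReal (y ^ (2 * lam - 1)) *
        ∫⁻ τ, g (√(1 + y ^ 2) * Real.cosh τ) := by
  rw [Measure.volume_eq_prod,
    lintegral_prod_symm _ (measurable_halfPlaneDensity lam hg x).aemeasurable,
    ← lintegral_indicator measurableSet_Ioi]
  refine lintegral_congr fun y => ?_
  by_cases hy : y ∈ Ioi (0 : ℝ)
  · simp only [halfPlaneDensity, indicator_of_mem hy]
    rw [lintegral_const_mul _ (by fun_prop), lintegral_horizontal]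
  · simp only [halfPlaneDensity, indicator_of_notMem hy, lintegral_zero]

/-- In geodesic polar coordinates the product measure becomes the half-plane density. -/
theorem lintegral_shift_eq_halfPlane (lam : ℝ) {g : ℝ → ENNReal} (hg : Measurable g) {x : ℝ}
    (hx : 0 ≤ x) :
    ∫⁻ t, ∫⁻ φ, g (shiftPoint (Real.cosh x) (Real.cosh t) φ) ∂(angleMeasure lam)
      ∂(gegenbauerMeasure lam) = ∫⁻ z, halfPlaneDensity lam g x z := by
  have hgm : Measurable fun z : ℝ × ℝ => g (shiftPoint (Real.cosh x) (Real.cosh z.1) z.2) :=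
    hg.comp (measurable_shiftPoint_right _)
  rw [lintegral_gegenbauerMeasure lam hgm.lintegral_prod_right', ← lintegral_comp_polarCoord_symm]
  have htarget : polarCoord.target = Ioi (0 : ℝ) ×ˢ Ioo (-Real.pi) Real.pi := rfl
  have hmeas : Measurable fun p : ℝ × ℝ =>
      ENNReal.ofReal p.1 • halfPlaneDensity lam g x (polarCoord.symm p) := by
    have h1 : Measurable fun p : ℝ × ℝ => (p.1 * Real.cos p.2, p.1 * Real.sin p.2) := by fun_prop
    exact (by fun_prop : Measurable fun p : ℝ × ℝ => ENNReal.ofReal p.1).smul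
      ((measurable_halfPlaneDensity lam hg x).comp h1)
  rw [htarget, Measure.volume_eq_prod, ← Measure.prod_restrict,
    lintegral_prod _ hmeas.aemeasurable]
  -- The polar radius is sinh t. Its differential contributes cosh t, which cancels the factor
  -- 1/√(1+y²+w²), while the polar Jacobian raises sinh^{2λ-1} t to sinh^{2λ} t.
  have h0 : Ioi (0 : ℝ) = Real.sinh '' Ioi 0 := by rw [sinh_image_Ioi, Real.sinh_zero]
  conv_rhs => rw [h0]
  rw [lintegral_sinh_image measurableSet_Ioi]
  refine setLIntegral_congr_fun measurableSet_Ioi fun t ht => ?_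
  have ht' : 0 < t := ht
  have hs : 0 < Real.sinh t := Real.sinh_pos_iff.2 ht'
  have hc := Real.cosh_pos t
  have hgt : Measurable fun φ => g (shiftPoint (Real.cosh x) (Real.cosh t) φ) :=
    hg.comp (measurable_shiftPoint_angle _ _)
  simp only [smul_eq_mul]
  have hint : Measurable fun φ => ENNReal.ofReal (Real.sin φ ^ (2 * lam - 1)) *
      g (shiftPoint (Real.cosh x) (Real.cosh t) φ) := (measurable_sin_rpow _).mul hgt
  rw [lintegral_angleMeasure lam hgt, ← lintegral_const_mul _ hint,
    ← lintegral_const_mul _ (by exact (hmeas.comp (measurable_prodMk_left (x := Real.sinh t)))),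
    ← lintegral_indicator measurableSet_Ioo, ← lintegral_indicator measurableSet_Ioo]
  refine lintegral_congr fun φ => ?_
  by_cases hφ : φ ∈ Ioo 0 Real.pi
  · have hφ2 : φ ∈ Ioo (-Real.pi) Real.pi := ⟨by linarith [hφ.1, Real.pi_pos], hφ.2⟩
    have hsin : 0 < Real.sin φ := Real.sin_pos_of_mem_Ioo hφ
    rw [indicator_of_mem hφ, indicator_of_mem hφ2, polarCoord_symm_apply]
    have hpos : Real.sinh t * Real.sin φ ∈ Ioi (0 : ℝ) := mul_pos hs hsin
    simp only [halfPlaneDensity, indicator_of_mem hpos]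
    have hsq : √(1 + (Real.sinh t * Real.sin φ) ^ 2 + (Real.sinh t * Real.cos φ) ^ 2) =
        Real.cosh t := by
      rw [show 1 + (Real.sinh t * Real.sin φ) ^ 2 + (Real.sinh t * Real.cos φ) ^ 2 =
        Real.cosh t ^ 2 by
          rw [Real.cosh_sq, mul_pow, mul_pow, Real.cos_sq']; ring]
      exact Real.sqrt_sq hc.le
    rw [hsq, shiftPoint_cosh hx ht'.le]
    have harg : Real.cosh t * Real.cosh x - Real.sinh t * Real.cos φ * Real.sinh x =
        Real.cosh x * Real.cosh t - Real.sinh x * Real.sinh t * Real.cos φ := by ring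
    rw [harg]
    simp only [← mul_assoc]
    congr 1
    rw [← ENNReal.ofReal_mul (by positivity), ← ENNReal.ofReal_mul (by positivity),
      ← ENNReal.ofReal_mul (by positivity), ← ENNReal.ofReal_mul (by positivity)]
    congr 1
    rw [Real.mul_rpow hs.le hsin.le, Real.rpow_sub_one hs.ne']
    field_simp
  -- Angles in (-π, 0] point outside the open upper half-plane, where the density vanishes.
  · rw [indicator_of_notMem hφ]
    by_cases hφ2 : φ ∈ Ioo (-Real.pi) Real.pi
    · have hneg : φ ≤ 0 := by
        by_contra h
        exact hφ ⟨not_le.1 h, hφ2.2⟩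
      have hsin : Real.sin φ ≤ 0 := Real.sin_nonpos_of_nonpos_of_neg_pi_le hneg hφ2.1.le
      have hnot : Real.sinh t * Real.sin φ ∉ Ioi (0 : ℝ) :=
        not_lt.2 (mul_nonpos_of_nonneg_of_nonpos hs.le hsin)
      rw [indicator_of_mem hφ2, polarCoord_symm_apply]
      simp only [halfPlaneDensity, indicator_of_notMem hnot, mul_zero]
    · rw [indicator_of_notMem hφ2]

/-- The generalized shift preserves the integral, up to the mass of the angular measure. -/
theorem lintegral_lintegral_shiftPoint (lam : ℝ) {g : ℝ → ENNReal} (hg : Measurable g) {x : ℝ}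
    (hx : 0 ≤ x) :
    ∫⁻ t, ∫⁻ φ, g (shiftPoint (Real.cosh x) (Real.cosh t) φ) ∂(angleMeasure lam)
      ∂(gegenbauerMeasure lam) =
    angleMeasure lam univ * ∫⁻ t, g (Real.cosh t) ∂(gegenbauerMeasure lam) := by
  -- The half-plane integral does not depend on x, so x may be replaced by 0, where the shift point
  -- is cosh t for every φ.
  rw [lintegral_shift_eq_halfPlane lam hg hx, lintegral_halfPlaneDensity lam hg,
    ← lintegral_halfPlaneDensity lam hg 0, ← lintegral_shift_eq_halfPlane lam hg le_rfl,
    ← lintegral_const_mul _ (by fun_prop)]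
  refine lintegral_congr fun t => ?_
  simp [shiftPoint, mul_comm]

/-! ### Convolution: Hölder, Young and transport of null sets -/

theorem measurable_lintegral_shiftPoint (lam v : ℝ) {g : ℝ → ENNReal} (hg : Measurable g) :
    Measurable fun t => ∫⁻ φ, g (shiftPoint v (Real.cosh t) φ) ∂(angleMeasure lam) :=
  (hg.comp (measurable_shiftPoint_right v)).lintegral_prod_right'

/-- The convolution of `k` with `h`, without the normalising constant of the shift. -/
noncomputable def shiftConv (lam : ℝ) (k h : ℝ → ENNReal) (v : ℝ) : ENNReal :=
  ∫⁻ s, (∫⁻ φ, k (shiftPoint v (Real.cosh s) φ) ∂(angleMeasure lam)) * h s ∂(gegenbauerMeasure lam)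

theorem shiftConv_eq_prod (lam : ℝ) {k h : ℝ → ENNReal} (hk : Measurable k) (hh : Measurable h)
    (v : ℝ) :
    shiftConv lam k h v = ∫⁻ z, k (shiftPoint v (Real.cosh z.1) z.2) * h z.1
      ∂((gegenbauerMeasure lam).prod (angleMeasure lam)) := by
  have hm : Measurable fun z : ℝ × ℝ => k (shiftPoint v (Real.cosh z.1) z.2) * h z.1 :=
    (hk.comp (measurable_shiftPoint_right v)).mul (hh.comp measurable_fst)
  rw [lintegral_prod _ hm.aemeasurable]
  refine lintegral_congr fun s => ?_
  exact (lintegral_mul_const _ (hk.comp (measurable_shiftPoint_angle _ _))).symm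

theorem measurable_shiftConv (lam : ℝ) {k h : ℝ → ENNReal} (hk : Measurable k)
    (hh : Measurable h) : Measurable (shiftConv lam k h) := by
  have h1 : Measurable fun z : ℝ × ℝ × ℝ =>
      k (shiftPoint z.1 (Real.cosh z.2.1) z.2.2) * h z.2.1 := by
    have : Measurable fun z : ℝ × ℝ × ℝ => shiftPoint z.1 (Real.cosh z.2.1) z.2.2 := by
      unfold shiftPoint; fun_prop
    exact (hk.comp this).mul (hh.comp (by fun_prop))
  have h2 : shiftConv lam k h = fun v => ∫⁻ z, k (shiftPoint v (Real.cosh z.1) z.2) * h z.1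
      ∂((gegenbauerMeasure lam).prod (angleMeasure lam)) :=
    funext fun v => shiftConv_eq_prod lam hk hh v
  rw [h2]
  exact h1.lintegral_prod_right'

theorem lintegral_prod_shiftPoint (lam : ℝ) {g : ℝ → ENNReal} (hg : Measurable g) {x : ℝ}
    (hx : 0 ≤ x) :
    ∫⁻ z, g (shiftPoint (Real.cosh x) (Real.cosh z.1) z.2)
      ∂((gegenbauerMeasure lam).prod (angleMeasure lam)) =
    angleMeasure lam univ * ∫⁻ t, g (Real.cosh t) ∂(gegenbauerMeasure lam) := by
  have hm : Measurable fun z : ℝ × ℝ => g (shiftPoint (Real.cosh x) (Real.cosh z.1) z.2) :=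
    hg.comp (measurable_shiftPoint_right _)
  rw [lintegral_prod _ hm.aemeasurable]
  exact lintegral_lintegral_shiftPoint lam hg hx

theorem lintegral_prod_fst (lam : ℝ) {h : ℝ → ENNReal} (hh : Measurable h) :
    ∫⁻ z, h z.1 ∂((gegenbauerMeasure lam).prod (angleMeasure lam)) =
    angleMeasure lam univ * ∫⁻ t, h t ∂(gegenbauerMeasure lam) := by
  have hm : Measurable fun z : ℝ × ℝ => h z.1 := hh.comp measurable_fst
  rw [lintegral_prod _ hm.aemeasurable, ← lintegral_const_mul _ hh]
  refine lintegral_congr fun t => ?_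
  simp [mul_comm]

/-- Hölder on the product of μ and the angular measure; invariance under the shift evaluates the
norm of the kernel factor independently of x. -/
theorem shiftConv_le (lam : ℝ) {a b : ℝ} (hab : a.HolderConjugate b) {k h : ℝ → ENNReal}
    (hk : Measurable k) (hh : Measurable h) {x : ℝ} (hx : 0 ≤ x) :
    shiftConv lam k h (Real.cosh x) ≤
      (angleMeasure lam univ * ∫⁻ t, k (Real.cosh t) ^ a ∂(gegenbauerMeasure lam)) ^ (1 / a) *
      (angleMeasure lam univ * ∫⁻ t, h t ^ b ∂(gegenbauerMeasure lam)) ^ (1 / b) := by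
  rw [shiftConv_eq_prod lam hk hh, ← lintegral_prod_shiftPoint lam (hk.pow_const a) hx,
    ← lintegral_prod_fst lam (hh.pow_const b)]
  exact ENNReal.lintegral_mul_le_Lp_mul_Lq _ hab
    (hk.comp (measurable_shiftPoint_right _)).aemeasurable (hh.comp measurable_fst).aemeasurable

/-- The convolution bound with the indicator of s as second factor. -/
theorem setLIntegral_shiftPoint_le (lam : ℝ) {a b : ℝ} (hab : a.HolderConjugate b)
    {g : ℝ → ENNReal} (hg : Measurable g) {s : Set ℝ} (hs : MeasurableSet s) {x : ℝ}
    (hx : 0 ≤ x) :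
    ∫⁻ t in s, ∫⁻ φ, g (shiftPoint (Real.cosh x) (Real.cosh t) φ) ∂(angleMeasure lam)
      ∂(gegenbauerMeasure lam) ≤
      (angleMeasure lam univ * ∫⁻ t, g (Real.cosh t) ^ a ∂(gegenbauerMeasure lam)) ^ (1 / a) *
      (angleMeasure lam univ * gegenbauerMeasure lam s) ^ (1 / b) := by
  have h := shiftConv_le lam hab hg (measurable_one.indicator hs) hx
  have h1 : (fun t => s.indicator (1 : ℝ → ENNReal) t ^ b) = s.indicator 1 := by
    funext t
    by_cases ht : t ∈ s
    · simp [ht]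
    · simp [ht, hab.symm.pos]
  rw [h1, lintegral_indicator_one hs] at h
  refine le_trans (le_of_eq ?_) h
  rw [shiftConv, ← lintegral_indicator hs]
  refine lintegral_congr fun t => ?_
  by_cases ht : t ∈ s
  · simp [ht]
  · simp [ht]

/-- Young's inequality for the convolution. -/
theorem lintegral_shiftConv_rpow_le {lam : ℝ} {p q : ℝ} (hpq : p.HolderConjugate q)
    {k h : ℝ → ENNReal} (hk : Measurable k) (hh : Measurable h) :
    ∫⁻ r, shiftConv lam k h (Real.cosh r) ^ p ∂(gegenbauerMeasure lam) ≤
      (angleMeasure lam univ * ∫⁻ t, k (Real.cosh t) ∂(gegenbauerMeasure lam)) ^ p *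
        ∫⁻ t, h t ^ p ∂(gegenbauerMeasure lam) := by
  set MK := angleMeasure lam univ * ∫⁻ t, k (Real.cosh t) ∂(gegenbauerMeasure lam) with hMK
  have hp := hpq.pos
  have hq := hpq.symm.pos
  have hsum : 1 / q + 1 / p = 1 := by
    have := hpq.symm.inv_add_inv_eq_one
    simpa using this
  -- Hölder with the splitting k = k^{1/q} · k^{1/p}, the second factor being paired with h.
  have key : ∀ r, 0 ≤ r → shiftConv lam k h (Real.cosh r) ^ p ≤
      MK ^ (p / q) * shiftConv lam k (fun s => h s ^ p) (Real.cosh r) := by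
    intro r hr
    have hkm := hk.comp (measurable_shiftPoint_right (Real.cosh r))
    have h1 : shiftConv lam k h (Real.cosh r) ≤
        MK ^ (1 / q) * shiftConv lam k (fun s => h s ^ p) (Real.cosh r) ^ (1 / p) := by
      rw [shiftConv_eq_prod lam hk hh, shiftConv_eq_prod lam hk (hh.pow_const p), hMK,
        ← lintegral_prod_shiftPoint lam hk hr]
      have hH := ENNReal.lintegral_mul_le_Lp_mul_Lq
        ((gegenbauerMeasure lam).prod (angleMeasure lam)) hpq.symm
        (f := fun z => k (shiftPoint (Real.cosh r) (Real.cosh z.1) z.2) ^ (1 / q))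
        (g := fun z => k (shiftPoint (Real.cosh r) (Real.cosh z.1) z.2) ^ (1 / p) * h z.1)
        (hkm.pow_const _).aemeasurable
        ((hkm.pow_const _).mul (hh.comp measurable_fst)).aemeasurable
      refine le_trans (le_of_eq (lintegral_congr fun z => ?_))
        (hH.trans (le_of_eq ?_))
      · simp only [Pi.mul_apply]
        rw [← mul_assoc, ← ENNReal.rpow_add_of_nonneg _ _ (by positivity) (by positivity), hsum,
          ENNReal.rpow_one]
      · congr 2
        · refine lintegral_congr fun z => ?_
          rw [← ENNReal.rpow_mul, one_div_mul_cancel hq.ne', ENNReal.rpow_one]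
        · refine lintegral_congr fun z => ?_
          rw [ENNReal.mul_rpow_of_nonneg _ _ hp.le, ← ENNReal.rpow_mul,
            one_div_mul_cancel hp.ne', ENNReal.rpow_one]
    calc _ ≤ (MK ^ (1 / q) * shiftConv lam k (fun s => h s ^ p) (Real.cosh r) ^ (1 / p)) ^ p :=
          ENNReal.rpow_le_rpow h1 hp.le
      _ = _ := by
          rw [ENNReal.mul_rpow_of_nonneg _ _ hp.le, ← ENNReal.rpow_mul, ← ENNReal.rpow_mul,
            one_div_mul_cancel hp.ne', ENNReal.rpow_one]
          congr 2; ring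
  -- After Tonelli, the symmetry of the shift point in its two radii lets invariance evaluate the
  -- integral of the kernel over r.
  have hint : ∫⁻ r, shiftConv lam k (fun s => h s ^ p) (Real.cosh r) ∂(gegenbauerMeasure lam) =
      MK * ∫⁻ t, h t ^ p ∂(gegenbauerMeasure lam) := by
    have hjoint : Measurable fun z : ℝ × ℝ =>
        (∫⁻ φ, k (shiftPoint (Real.cosh z.1) (Real.cosh z.2) φ) ∂(angleMeasure lam)) *
          h z.2 ^ p := by
      have : Measurable fun z : (ℝ × ℝ) × ℝ =>
          k (shiftPoint (Real.cosh z.1.1) (Real.cosh z.1.2) z.2) := by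
        refine hk.comp ?_
        unfold shiftPoint; fun_prop
      exact this.lintegral_prod_right'.mul ((hh.comp measurable_snd).pow_const p)
    unfold shiftConv
    rw [lintegral_lintegral_swap hjoint.aemeasurable, ← lintegral_const_mul _ (hh.pow_const p)]
    refine lintegral_congr_ae ?_
    filter_upwards [ae_gegenbauerMeasure_pos lam] with s hs
    rw [lintegral_mul_const]
    · simp_rw [shiftPoint_comm _ (Real.cosh s)]
      rw [lintegral_lintegral_shiftPoint lam hk hs.le]
    · simp_rw [shiftPoint_comm _ (Real.cosh s)]
      exact measurable_lintegral_shiftPoint lam _ hk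
  calc _ ≤ ∫⁻ r, MK ^ (p / q) * shiftConv lam k (fun s => h s ^ p) (Real.cosh r)
        ∂(gegenbauerMeasure lam) := by
        refine lintegral_mono_ae ?_
        filter_upwards [ae_gegenbauerMeasure_pos lam] with r hr using key r hr.le
    _ = MK ^ (p / q) * (MK * ∫⁻ t, h t ^ p ∂(gegenbauerMeasure lam)) := by
        have hm : Measurable fun r => shiftConv lam k (fun s => h s ^ p) (Real.cosh r) :=
          (measurable_shiftConv lam hk (hh.pow_const p)).comp Real.measurable_cosh
        rw [lintegral_const_mul _ hm, hint]
    _ = _ := by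
        rw [← mul_assoc]
        congr 1
        conv_lhs => rw [← ENNReal.rpow_one MK, ← ENNReal.rpow_mul]
        rw [← ENNReal.rpow_add_of_nonneg _ _ (by positivity) zero_le_one]
        congr 1
        field_simp at hsum ⊢
        linarith

/-- Invariance applied to the indicator of the exceptional set. It lets properties known only almost
everywhere, such as convergence of the fractional integral, be used under the shift. -/
theorem ae_ae_shiftPoint (lam : ℝ) {P : ℝ → Prop} (hP : MeasurableSet {y | P y})
    (h : ∀ᵐ t ∂(gegenbauerMeasure lam), P (Real.cosh t)) {x : ℝ} (hx : 0 ≤ x) :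
    ∀ᵐ t ∂(gegenbauerMeasure lam), ∀ᵐ φ ∂(angleMeasure lam),
      P (shiftPoint (Real.cosh x) (Real.cosh t) φ) := by
  have hm : Measurable ({y | P y}ᶜ.indicator (1 : ℝ → ENNReal)) := measurable_one.indicator hP.compl
  have h0 := lintegral_lintegral_shiftPoint lam hm hx
  have h1 : ∫⁻ t, {y | P y}ᶜ.indicator (1 : ℝ → ENNReal) (Real.cosh t)
      ∂(gegenbauerMeasure lam) = 0 := by
    refine (lintegral_eq_zero_iff (hm.comp Real.measurable_cosh)).2 ?_
    filter_upwards [h] with t ht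
    simp [ht]
  rw [h1, mul_zero, lintegral_eq_zero_iff (measurable_lintegral_shiftPoint lam _ hm)] at h0
  filter_upwards [h0] with t ht
  filter_upwards [(lintegral_eq_zero_iff (hm.comp (measurable_shiftPoint_angle _ _))).1 ht] with φ hφ
  by_contra hn
  simp [hn] at hφ

/-! ### The truncated kernel, its majorant and their integrals -/

/-- The kernel `(sinh x)^{-β}` truncated at height `(sinh R)^{-β}`, as a function of `cosh x`. -/
noncomputable def truncKernel (β R y : ℝ) : ℝ :=
  max √(y ^ 2 - 1) (Real.sinh R) ^ (-β)

/-- A bound for the oscillation at scale `R` of the truncated kernel. -/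
noncomputable def kernelMajorant (β R y : ℝ) : ℝ :=
  R * (√(1 + max √(y ^ 2 - 1) (Real.sinh R) ^ 2) / max √(y ^ 2 - 1) (Real.sinh R)) *
    max √(y ^ 2 - 1) (Real.sinh R) ^ (-β)

theorem measurable_truncKernel (β R : ℝ) : Measurable (truncKernel β R) := by
  unfold truncKernel; fun_prop

theorem measurable_kernelMajorant (β R : ℝ) : Measurable (kernelMajorant β R) := by
  unfold kernelMajorant; fun_prop

theorem measurable_rieszGegenbauerKernel (lam α : ℝ) :
    Measurable (rieszGegenbauerKernel lam α) := by
  unfold rieszGegenbauerKernel; fun_prop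

theorem max_sqrt_cosh {t : ℝ} (ht : 0 ≤ t) (R : ℝ) :
    max √(Real.cosh t ^ 2 - 1) (Real.sinh R) = Real.sinh (max t R) := by
  rw [sqrt_cosh_sq_sub_one ht]
  exact (Real.sinhOrderIso.monotone.map_max (a := t) (b := R)).symm

theorem truncKernel_cosh (β R : ℝ) {t : ℝ} (ht : 0 ≤ t) :
    truncKernel β R (Real.cosh t) = Real.sinh (max t R) ^ (-β) := by
  rw [truncKernel, max_sqrt_cosh ht]

theorem sqrt_one_add_sinh_sq (t : ℝ) : √(1 + Real.sinh t ^ 2) = Real.cosh t := by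
  rw [add_comm, ← Real.cosh_sq, Real.sqrt_sq (Real.cosh_pos t).le]

theorem kernelMajorant_cosh (β R : ℝ) {t : ℝ} (ht : 0 ≤ t) :
    kernelMajorant β R (Real.cosh t) =
      R * (Real.cosh (max t R) / Real.sinh (max t R)) * Real.sinh (max t R) ^ (-β) := by
  rw [kernelMajorant, max_sqrt_cosh ht, sqrt_one_add_sinh_sq]

theorem truncKernel_nonneg {β R : ℝ} (y : ℝ) : 0 ≤ truncKernel β R y :=
  Real.rpow_nonneg (le_max_of_le_left (Real.sqrt_nonneg _)) _

theorem truncKernel_le {β R : ℝ} (hβ : 0 ≤ β) (hR : 0 < R) (y : ℝ) :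
    truncKernel β R y ≤ Real.sinh R ^ (-β) :=
  Real.rpow_le_rpow_of_nonpos (Real.sinh_pos_iff.2 hR) (le_max_right _ _) (by linarith)

theorem truncKernel_one_le_kernelMajorant (β y : ℝ) :
    truncKernel β 1 y ≤ kernelMajorant β 1 y := by
  have h : 0 < max √(y ^ 2 - 1) (Real.sinh 1) :=
    lt_max_of_lt_right (Real.sinh_pos_iff.2 one_pos)
  unfold kernelMajorant truncKernel
  refine le_mul_of_one_le_left (Real.rpow_nonneg h.le _) ?_
  rw [one_mul, one_le_div h]
  exact Real.le_sqrt_of_sq_le (by linarith)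

theorem lintegral_Ioo_rpow {a A : ℝ} (ha : 0 < a) (hA : 0 ≤ A) :
    ∫⁻ u in Ioo 0 A, ENNReal.ofReal (u ^ (a - 1)) = ENNReal.ofReal (A ^ a / a) := by
  have hi : IntervalIntegrable (fun u : ℝ => u ^ (a - 1)) volume 0 A :=
    intervalIntegral.intervalIntegrable_rpow' (by linarith)
  rw [restrict_Ioo_eq_restrict_Ioc, ← ofReal_integral_eq_lintegral_ofReal hi.1,
    ← intervalIntegral.integral_of_le hA, integral_rpow (Or.inl (by linarith))]
  · simp [ha.ne']
  · filter_upwards [ae_restrict_mem measurableSet_Ioc] with u hu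
    exact Real.rpow_nonneg hu.1.le _

theorem lintegral_Ioi_rpow_neg_two {A : ℝ} (hA : 0 < A) :
    ∫⁻ u in Ioi A, ENNReal.ofReal (u ^ (-2 : ℝ)) = ENNReal.ofReal (1 / A) := by
  rw [← ofReal_integral_eq_lintegral_ofReal (integrableOn_Ioi_rpow_of_lt (by norm_num) hA),
    integral_Ioi_rpow_of_lt (by norm_num) hA]
  · norm_num [Real.rpow_neg_one]
  · filter_upwards [ae_restrict_mem measurableSet_Ioi] with u hu
    exact Real.rpow_nonneg (hA.le.trans (le_of_lt hu)) _

theorem lintegral_cosh_mul_sinh_rpow {a : ℝ} (ha : 0 < a) {R : ℝ} (hR : 0 < R) :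
    ∫⁻ t in Ioo 0 R, ENNReal.ofReal (Real.cosh t) * ENNReal.ofReal (Real.sinh t ^ (a - 1)) =
      ENNReal.ofReal (Real.sinh R ^ a / a) := by
  rw [← lintegral_sinh_image measurableSet_Ioo (fun u => ENNReal.ofReal (u ^ (a - 1))),
    sinh_image_Ioo, Real.sinh_zero, lintegral_Ioo_rpow ha (Real.sinh_nonneg_iff.2 hR.le)]

theorem gegenbauerInterval_zero {r : ℝ} (hr : 0 < r) : gegenbauerInterval 0 r = Ico 0 r := by
  ext t
  simp only [gegenbauerInterval, zero_sub, zero_add, mem_inter_iff, mem_Ioo, mem_Ici, mem_Ico]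
  constructor
  · rintro ⟨⟨_, h⟩, h0⟩; exact ⟨h0, h⟩
  · rintro ⟨h0, h⟩; exact ⟨⟨by linarith, h⟩, h0⟩

theorem gegenbauerMeasure_interval (lam : ℝ) {r : ℝ} (hr : 0 < r) :
    gegenbauerMeasure lam (gegenbauerInterval 0 r) =
      ∫⁻ t in Ioo 0 r, ENNReal.ofReal (Real.sinh t ^ (2 * lam)) := by
  rw [gegenbauerInterval_zero hr, gegenbauerMeasure, withDensity_apply _ measurableSet_Ico,
    Measure.restrict_restrict measurableSet_Ico,
    inter_eq_left.2 (Ico_subset_Icc_self.trans Icc_subset_Ici_self),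
    restrict_Ioo_eq_restrict_Ico]

theorem gegenbauerMeasure_interval_lt_top {lam : ℝ} (hlam : 0 < lam) {r : ℝ} (hr : 0 < r) :
    gegenbauerMeasure lam (gegenbauerInterval 0 r) < ⊤ := by
  rw [gegenbauerMeasure_interval lam hr]
  have h := lintegral_cosh_mul_sinh_rpow (a := 2 * lam + 1) (by linarith) hr
  refine lt_of_le_of_lt ?_ (h.trans_lt ENNReal.ofReal_lt_top)
  refine lintegral_mono fun t => ?_
  rw [add_sub_cancel_right]
  refine le_mul_of_one_le_left zero_le ?_
  rw [ENNReal.one_le_ofReal]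
  exact Real.one_le_cosh t

/-- Inserting cosh t makes the density exactly integrable; on (0, R) with R ≤ 1 this costs at most a
factor cosh 1. -/
theorem le_gegenbauerMeasure_interval {lam : ℝ} (hlam : 0 < lam) {r R : ℝ} (hR : 0 < R)
    (hR1 : R ≤ 1) (hRr : R ≤ r) :
    ENNReal.ofReal (Real.sinh R ^ (2 * lam + 1) / (2 * lam + 1)) ≤
      ENNReal.ofReal (Real.cosh 1) * gegenbauerMeasure lam (gegenbauerInterval 0 r) := by
  rw [gegenbauerMeasure_interval lam (hR.trans_le hRr),
    ← lintegral_cosh_mul_sinh_rpow (by linarith) hR, ← lintegral_const_mul _ (by fun_prop)]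
  refine (setLIntegral_mono' measurableSet_Ioo fun t ht => ?_).trans
    (lintegral_mono_set (Ioo_subset_Ioo_right hRr))
  rw [add_sub_cancel_right]
  gcongr ENNReal.ofReal ?_ * _
  rw [Real.cosh_le_cosh, abs_of_pos ht.1, abs_of_pos one_pos]
  exact ht.2.le.trans hR1

/-- The difference vanishes for t ≥ R and is at most sinh^{-β} t below R. Against the density this
leaves sinh^{α-1} t, which is integrated exactly after inserting cosh t ≥ 1. -/
theorem lintegral_kernel_sub_truncKernel_le {lam α : ℝ} (hα : 0 < α)
    (hα' : α < 2 * lam + 1) {R : ℝ} (hR : 0 < R) :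
    ∫⁻ t, ‖rieszGegenbauerKernel lam α (Real.cosh t) -
        truncKernel (2 * lam + 1 - α) R (Real.cosh t)‖ₑ ∂(gegenbauerMeasure lam) ≤
      ENNReal.ofReal (Real.sinh R ^ α / α) := by
  have hm : Measurable fun t => ‖rieszGegenbauerKernel lam α (Real.cosh t) -
        truncKernel (2 * lam + 1 - α) R (Real.cosh t)‖ₑ := by
    have h1 := (measurable_rieszGegenbauerKernel lam α).comp Real.measurable_cosh
    have h2 := (measurable_truncKernel (2 * lam + 1 - α) R).comp Real.measurable_cosh
    exact (h1.sub h2).enorm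
  rw [lintegral_gegenbauerMeasure lam hm, ← lintegral_cosh_mul_sinh_rpow hα hR,
    ← lintegral_indicator measurableSet_Ioi, ← lintegral_indicator measurableSet_Ioo]
  refine lintegral_mono fun t => ?_
  by_cases ht : t ∈ Ioi (0 : ℝ)
  swap
  · rw [indicator_of_notMem ht]; exact zero_le
  have ht0 : 0 < t := ht
  have hs : 0 < Real.sinh t := Real.sinh_pos_iff.2 ht0
  rw [indicator_of_mem ht, truncKernel_cosh _ _ ht0.le, rieszGegenbauerKernel,
    sqrt_cosh_sq_sub_one ht0.le]
  have hexp : α - 2 * lam - 1 = -(2 * lam + 1 - α) := by ring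
  rcases lt_or_ge t R with h | h
  · rw [indicator_of_mem (show t ∈ Ioo 0 R from ⟨ht0, h⟩), max_eq_right h.le, hexp]
    have hb : ‖Real.sinh t ^ (-(2 * lam + 1 - α)) - Real.sinh R ^ (-(2 * lam + 1 - α))‖ₑ ≤
        ENNReal.ofReal (Real.sinh t ^ (-(2 * lam + 1 - α))) := by
      rw [Real.enorm_eq_ofReal_abs]
      refine ENNReal.ofReal_le_ofReal ?_
      have h1 : Real.sinh R ^ (-(2 * lam + 1 - α)) ≤ Real.sinh t ^ (-(2 * lam + 1 - α)) :=
        Real.rpow_le_rpow_of_nonpos hs (Real.sinh_le_sinh.2 h.le) (by linarith)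
      have h2 : 0 ≤ Real.sinh R ^ (-(2 * lam + 1 - α)) :=
        Real.rpow_nonneg (Real.sinh_nonneg_iff.2 hR.le) _
      rw [abs_of_nonneg (by linarith)]
      linarith
    refine (mul_le_mul' le_rfl hb).trans ?_
    rw [← ENNReal.ofReal_mul (by positivity), ← Real.rpow_add hs,
      show 2 * lam + -(2 * lam + 1 - α) = α - 1 by ring]
    refine le_mul_of_one_le_left zero_le ?_
    rw [ENNReal.one_le_ofReal]
    exact Real.one_le_cosh t
  · rw [max_eq_left h, hexp, sub_self, enorm_zero, mul_zero]
    exact zero_le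

/-- Since coth decreases and R ≤ sinh R, R coth b ≤ R coth R ≤ cosh R. -/
theorem coth_mul_le {R b : ℝ} (hR : 0 < R) (hR1 : R ≤ 1) (hb : R ≤ b) :
    R * (Real.cosh b / Real.sinh b) ≤ Real.cosh 1 := by
  have hsR : 0 < Real.sinh R := Real.sinh_pos_iff.2 hR
  have hsb : 0 < Real.sinh b := Real.sinh_pos_iff.2 (hR.trans_le hb)
  have hcR : Real.cosh R ≤ Real.cosh 1 := by
    rw [Real.cosh_le_cosh, abs_of_pos hR, abs_of_pos one_pos]; exact hR1
  have h1 : Real.sinh R * Real.cosh b ≤ Real.cosh R * Real.sinh b := by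
    have : 0 ≤ Real.sinh (b - R) := Real.sinh_nonneg_iff.2 (by linarith)
    rw [Real.sinh_sub] at this
    linarith
  rw [← mul_div_assoc, div_le_iff₀ hsb]
  have h2 : R ≤ Real.sinh R := Real.self_le_sinh_iff.2 hR.le
  have hcb := Real.cosh_pos b
  nlinarith

/-- The bound is uniform in R because βq = 2λ+1 is critical. Below R the value is of order
sinh^{-(2λ+1)} R on a set of mass of order sinh^{2λ+1} R; above R the factor R coth t supplies the
decay that sinh^{-β} alone lacks. -/
theorem lintegral_kernelMajorant_rpow_le {lam β q R : ℝ} (hlam : 0 < lam) (hq : 1 ≤ q)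
    (hβq : β * q = 2 * lam + 1) (hR : 0 < R) (hR1 : R ≤ 1) :
    ∫⁻ t, ENNReal.ofReal (kernelMajorant β R (Real.cosh t)) ^ q ∂(gegenbauerMeasure lam) ≤
      ENNReal.ofReal (Real.cosh 1 ^ q / (2 * lam + 1) + Real.cosh 1 ^ (q - 1)) := by
  have hc1 : 0 < Real.cosh 1 := Real.cosh_pos 1
  have hsR : 0 < Real.sinh R := Real.sinh_pos_iff.2 hR
  have hm : Measurable fun t => ENNReal.ofReal (kernelMajorant β R (Real.cosh t)) ^ q :=
    ((measurable_kernelMajorant β R).comp Real.measurable_cosh).ennreal_ofReal.pow_const q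
  have hpow : ∀ b, R ≤ b → (R * (Real.cosh b / Real.sinh b) * Real.sinh b ^ (-β)) ^ q =
      (R * (Real.cosh b / Real.sinh b)) ^ q * Real.sinh b ^ (-(2 * lam + 1)) := by
    intro b hb
    have hsb : 0 < Real.sinh b := Real.sinh_pos_iff.2 (hR.trans_le hb)
    have := Real.cosh_pos b
    rw [Real.mul_rpow (by positivity) (by positivity), ← Real.rpow_mul hsb.le, neg_mul, hβq]
  have hofReal : ∀ t, 0 < t → ENNReal.ofReal (kernelMajorant β R (Real.cosh t)) ^ q =
      ENNReal.ofReal ((R * (Real.cosh (max t R) / Real.sinh (max t R))) ^ q *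
        Real.sinh (max t R) ^ (-(2 * lam + 1))) := by
    intro t ht
    have hsb : 0 < Real.sinh (max t R) := Real.sinh_pos_iff.2 (hR.trans_le (le_max_right _ _))
    have := Real.cosh_pos (max t R)
    rw [kernelMajorant_cosh _ _ ht.le, ENNReal.ofReal_rpow_of_nonneg (by positivity) (by linarith),
      hpow _ (le_max_right _ _)]
  rw [lintegral_gegenbauerMeasure lam hm, ← Ioc_union_Ioi_eq_Ioi hR.le,
    ENNReal.ofReal_add (by positivity) (by positivity)]
  refine (lintegral_union_le _ _ _).trans (add_le_add ?_ ?_)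
  · rw [← restrict_Ioo_eq_restrict_Ioc]
    have hI := lintegral_cosh_mul_sinh_rpow (a := 2 * lam + 1) (by linarith) hR
    calc _ ≤ ∫⁻ t in Ioo 0 R, ENNReal.ofReal (Real.cosh 1 ^ q * Real.sinh R ^ (-(2 * lam + 1))) *
          (ENNReal.ofReal (Real.cosh t) *
            ENNReal.ofReal (Real.sinh t ^ (2 * lam + 1 - 1))) := by
          refine setLIntegral_mono' measurableSet_Ioo fun t ht => ?_
          rw [hofReal t ht.1, max_eq_right ht.2.le, mul_comm, add_sub_cancel_right]
          have hcR := Real.cosh_pos R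
          refine mul_le_mul' (ENNReal.ofReal_le_ofReal ?_) (le_mul_of_one_le_left zero_le ?_)
          · gcongr
            exact coth_mul_le hR hR1 le_rfl
          · rw [ENNReal.one_le_ofReal]
            exact Real.one_le_cosh t
      _ = _ := by
          rw [lintegral_const_mul _ (by fun_prop), hI, ← ENNReal.ofReal_mul (by positivity)]
          congr 1
          rw [Real.rpow_neg hsR.le]
          field_simp
  · calc _ ≤ ∫⁻ t in Ioi R, ENNReal.ofReal (Real.cosh 1 ^ (q - 1) * R) *
          (ENNReal.ofReal (Real.cosh t) * ENNReal.ofReal (Real.sinh t ^ (-2 : ℝ))) := by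
          refine setLIntegral_mono' measurableSet_Ioi fun t ht => ?_
          have htR : R < t := ht
          have ht0 : 0 < t := hR.trans htR
          have hs : 0 < Real.sinh t := Real.sinh_pos_iff.2 ht0
          have hc := Real.cosh_pos t
          rw [hofReal t ht0, max_eq_left htR.le, ← ENNReal.ofReal_mul (by positivity),
            ← ENNReal.ofReal_mul (by positivity), ← ENNReal.ofReal_mul (by positivity)]
          refine ENNReal.ofReal_le_ofReal ?_
          have hx : 0 < R * (Real.cosh t / Real.sinh t) := by positivity
          -- One factor R coth t is kept and the other q - 1 are bounded. The kept factor turns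
          -- sinh^{-1} t, whose integral would grow like log(1/R), into R cosh t sinh^{-2} t, whose
          -- integral is R / sinh R ≤ 1.
          have h1 : (R * (Real.cosh t / Real.sinh t)) ^ q ≤
              Real.cosh 1 ^ (q - 1) * (R * (Real.cosh t / Real.sinh t)) := by
            have : (R * (Real.cosh t / Real.sinh t)) ^ q =
                (R * (Real.cosh t / Real.sinh t)) ^ (q - 1) *
                  (R * (Real.cosh t / Real.sinh t)) := by
              rw [← Real.rpow_add_one hx.ne', sub_add_cancel]
            rw [this]
            gcongr
            exact coth_mul_le hR hR1 htR.le
          have h2 : Real.sinh t ^ (2 * lam) * Real.sinh t ^ (-(2 * lam + 1)) / Real.sinh t =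
              Real.sinh t ^ (-2 : ℝ) := by
            rw [← Real.rpow_add hs, ← Real.rpow_sub_one hs.ne']
            congr 1; ring
          calc _ ≤ Real.sinh t ^ (2 * lam) *
                (Real.cosh 1 ^ (q - 1) * (R * (Real.cosh t / Real.sinh t)) *
                  Real.sinh t ^ (-(2 * lam + 1))) := by gcongr
            _ = Real.cosh 1 ^ (q - 1) * R * (Real.cosh t *
                (Real.sinh t ^ (2 * lam) * Real.sinh t ^ (-(2 * lam + 1)) / Real.sinh t)) := by
                ring
            _ = _ := by rw [h2]
      _ = ENNReal.ofReal (Real.cosh 1 ^ (q - 1) * (R / Real.sinh R)) := by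
          rw [lintegral_const_mul _ (by
            exact (by fun_prop : Measurable fun t => ENNReal.ofReal (Real.cosh t)).mul
              (measurable_sinh_rpow _)),
            ← lintegral_sinh_image measurableSet_Ioi (fun u => ENNReal.ofReal (u ^ (-2 : ℝ))),
            sinh_image_Ioi, lintegral_Ioi_rpow_neg_two hsR, ← ENNReal.ofReal_mul (by positivity)]
          congr 1; ring
      _ ≤ _ := by
          refine ENNReal.ofReal_le_ofReal (mul_le_of_le_one_right (by positivity) ?_)
          rw [div_le_one hsR]
          exact Real.self_le_sinh_iff.2 hR.le

/-! ### Oscillation of the truncated kernel -/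

/-- The tangent-line bound w^{-β} ≥ 1 - β(w - 1) at w = v/u, obtained from e^y ≥ 1 + y and log w ≤ w
- 1. -/
theorem rpow_neg_sub_rpow_neg_le {β u v : ℝ} (hβ : 0 ≤ β) (hu : 0 < u) (huv : u ≤ v) :
    u ^ (-β) - v ^ (-β) ≤ β * u ^ (-β - 1) * (v - u) := by
  have hv : 0 < v := hu.trans_le huv
  have hw : 0 < v / u := div_pos hv hu
  have h1 : 1 - β * (v / u - 1) ≤ (v / u) ^ (-β) := by
    rw [Real.rpow_def_of_pos hw]
    have h2 := Real.add_one_le_exp (Real.log (v / u) * -β)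
    have h3 := mul_le_mul_of_nonneg_left (Real.log_le_sub_one_of_pos hw) hβ
    linarith
  have h4 : v ^ (-β) = u ^ (-β) * (v / u) ^ (-β) := by
    rw [← Real.mul_rpow hu.le hw.le, mul_div_cancel₀ _ hu.ne']
  have hp : 0 < u ^ (-β) := Real.rpow_pos_of_pos hu _
  have h5 : β * u ^ (-β - 1) * (v - u) = u ^ (-β) * (β * (v / u - 1)) := by
    rw [Real.rpow_sub_one hu.ne']
    field_simp
  rw [h4, h5]
  nlinarith

theorem sinh_sub_sinh_le {u v : ℝ} (hu : 0 ≤ u) (huv : u ≤ v) :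
    Real.sinh v - Real.sinh u ≤ (v - u) * Real.cosh v := by
  rcases huv.eq_or_lt with rfl | h
  · simp
  obtain ⟨c, hc, hc'⟩ := exists_hasDerivAt_eq_slope Real.sinh Real.cosh h
    Real.continuous_sinh.continuousOn (fun x _ => Real.hasDerivAt_sinh x)
  have hpos : 0 < v - u := by linarith
  rw [eq_div_iff hpos.ne'] at hc'
  have hcv : Real.cosh c ≤ Real.cosh v := by
    rw [Real.cosh_le_cosh, abs_of_nonneg (hu.trans hc.1.le), abs_of_nonneg (hu.trans huv)]
    exact hc.2.le
  nlinarith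

theorem cosh_le_cosh_one {R : ℝ} (hR : 0 ≤ R) (hR1 : R ≤ 1) : Real.cosh R ≤ Real.cosh 1 := by
  rw [Real.cosh_le_cosh, abs_of_nonneg hR, abs_of_pos one_pos]; exact hR1

/-- A doubling property: sinh(a - R) ≥ 0 bounds the second term of the addition formula for sinh(a +
R) by the first. -/
theorem sinh_le_of_le_add {a b R : ℝ} (hR : 0 < R) (hR1 : R ≤ 1) (ha : R ≤ a)
    (hab : b ≤ a + R) : Real.sinh b ≤ 2 * Real.cosh 1 * Real.sinh a := by
  have h1 : Real.sinh b ≤ Real.sinh (a + R) := Real.sinh_le_sinh.2 hab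
  have h2 : 0 ≤ Real.sinh (a - R) := Real.sinh_nonneg_iff.2 (by linarith)
  rw [Real.sinh_add] at h1
  rw [Real.sinh_sub] at h2
  have h3 := cosh_le_cosh_one hR.le hR1
  have h4 : 0 ≤ Real.sinh a := Real.sinh_nonneg_iff.2 (by linarith)
  nlinarith

theorem cosh_le_of_le_add {a b R : ℝ} (hR : 0 < R) (hR1 : R ≤ 1) (hb : 0 ≤ b) (ha : R ≤ a)
    (hab : b ≤ a + R) : Real.cosh b ≤ 2 * Real.cosh 1 * Real.cosh a := by
  have h1 : Real.cosh b ≤ Real.cosh (a + R) := by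
    rw [Real.cosh_le_cosh, abs_of_nonneg hb, abs_of_nonneg (by linarith)]; exact hab
  have h2 := Real.cosh_pos (a - R)
  rw [Real.cosh_add] at h1
  rw [Real.cosh_sub] at h2
  have h3 := cosh_le_cosh_one hR.le hR1
  have h4 := Real.cosh_pos a
  nlinarith

theorem abs_sinh_rpow_neg_sub_le {β a b R : ℝ} (hβ : 0 ≤ β) (hR : 0 < R) (hR1 : R ≤ 1)
    (ha : R ≤ a) (hb : R ≤ b) (hab : |a - b| ≤ R) :
    |Real.sinh a ^ (-β) - Real.sinh b ^ (-β)| ≤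
      β * (2 * Real.cosh 1) ^ (β + 2) *
        (R * (Real.cosh b / Real.sinh b) * Real.sinh b ^ (-β)) := by
  have hc : 0 < 2 * Real.cosh 1 := by have := Real.cosh_pos 1; positivity
  have hsb : 0 < Real.sinh b := Real.sinh_pos_iff.2 (hR.trans_le hb)
  have hcb := Real.cosh_pos b
  have hc1 : 1 ≤ 2 * Real.cosh 1 := by linarith [Real.one_le_cosh 1]
  have h1 := abs_le.1 hab
  -- An ordered version, used with b as either endpoint. The exponent β + 2 counts β + 1 factors
  -- from replacing sinh m by sinh b, and one from replacing cosh M by cosh b.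
  have main : ∀ m M : ℝ, R ≤ m → m ≤ M → M - m ≤ R → b ≤ m + R → M ≤ b + R →
      Real.sinh m ^ (-β) - Real.sinh M ^ (-β) ≤ β * (2 * Real.cosh 1) ^ (β + 2) *
        (R * (Real.cosh b / Real.sinh b) * Real.sinh b ^ (-β)) := by
    intro m M hm hmM hMm hbm hMb
    have hsm : 0 < Real.sinh m := Real.sinh_pos_iff.2 (hR.trans_le hm)
    have h2 := rpow_neg_sub_rpow_neg_le hβ hsm (Real.sinh_le_sinh.2 hmM)
    have h3 : Real.sinh M - Real.sinh m ≤ R * (2 * Real.cosh 1 * Real.cosh b) :=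
      (sinh_sub_sinh_le (hR.le.trans hm) hmM).trans
        (mul_le_mul hMm (cosh_le_of_le_add hR hR1 (by linarith) hb hMb) (Real.cosh_pos M).le hR.le)
    have h4 : Real.sinh m ^ (-β - 1) ≤ (2 * Real.cosh 1) ^ (β + 1) * Real.sinh b ^ (-β - 1) := by
      have h5 : Real.sinh b / (2 * Real.cosh 1) ≤ Real.sinh m := by
        rw [div_le_iff₀ hc, mul_comm]; exact sinh_le_of_le_add hR hR1 hm hbm
      refine (Real.rpow_le_rpow_of_nonpos (by positivity) h5 (by linarith)).trans (le_of_eq ?_)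
      rw [Real.div_rpow hsb.le hc.le, show -β - 1 = -(β + 1) by ring, Real.rpow_neg hc.le (β + 1),
        div_inv_eq_mul, mul_comm]
    have h6 : 0 ≤ Real.sinh M - Real.sinh m := sub_nonneg.2 (Real.sinh_le_sinh.2 hmM)
    calc _ ≤ β * Real.sinh m ^ (-β - 1) * (Real.sinh M - Real.sinh m) := h2
      _ ≤ β * ((2 * Real.cosh 1) ^ (β + 1) * Real.sinh b ^ (-β - 1)) *
          (R * (2 * Real.cosh 1 * Real.cosh b)) := by gcongr
      _ = _ := by
        rw [Real.rpow_sub_one hsb.ne', show β + 2 = β + 1 + 1 by ring,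
          Real.rpow_add_one hc.ne' (β + 1)]
        ring
  rcases le_total a b with h | h
  · have h7 := main a b ha h (by linarith) (by linarith) (by linarith)
    have h8 := Real.rpow_le_rpow_of_nonpos (Real.sinh_pos_iff.2 (hR.trans_le ha))
      (Real.sinh_le_sinh.2 h) (neg_nonpos.2 hβ)
    rwa [abs_of_nonneg (by linarith)]
  · have h7 := main b a hb h (by linarith) (by linarith) (by linarith)
    have h8 := Real.rpow_le_rpow_of_nonpos hsb (Real.sinh_le_sinh.2 h) (neg_nonpos.2 hβ)
    rwa [abs_sub_comm, abs_of_nonneg (by linarith)]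

theorem cosh_sub_le_shiftPoint {x t : ℝ} (hx : 0 ≤ x) (ht : 0 ≤ t) (φ : ℝ) :
    Real.cosh (x - t) ≤ shiftPoint (Real.cosh x) (Real.cosh t) φ := by
  rw [shiftPoint_cosh hx ht, Real.cosh_sub]
  have h := mul_nonneg (Real.sinh_nonneg_iff.2 hx) (Real.sinh_nonneg_iff.2 ht)
  nlinarith [Real.cos_le_one φ]

theorem shiftPoint_le_cosh_add {x t : ℝ} (hx : 0 ≤ x) (ht : 0 ≤ t) (φ : ℝ) :
    shiftPoint (Real.cosh x) (Real.cosh t) φ ≤ Real.cosh (x + t) := by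
  rw [shiftPoint_cosh hx ht, Real.cosh_add]
  have h := mul_nonneg (Real.sinh_nonneg_iff.2 hx) (Real.sinh_nonneg_iff.2 ht)
  nlinarith [Real.neg_one_le_cos φ]

/-- By the law of cosines r is the third side of a hyperbolic triangle with sides x and t, so it
lies between |x - t| and x + t. -/
theorem exists_cosh_eq_shiftPoint {x t : ℝ} (hx : 0 ≤ x) (ht : 0 ≤ t) (φ : ℝ) :
    ∃ r, 0 ≤ r ∧ |r - x| ≤ t ∧ Real.cosh r = shiftPoint (Real.cosh x) (Real.cosh t) φ := by
  have h1 := cosh_sub_le_shiftPoint hx ht φ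
  have h2 := shiftPoint_le_cosh_add hx ht φ
  have h3 : 1 ≤ shiftPoint (Real.cosh x) (Real.cosh t) φ := (Real.one_le_cosh _).trans h1
  have h0 := Real.arcosh_nonneg h3
  rw [← Real.cosh_arcosh h3] at h1 h2
  refine ⟨_, h0, ?_, Real.cosh_arcosh h3⟩
  rw [Real.cosh_le_cosh, abs_of_nonneg h0] at h1 h2
  rw [abs_of_nonneg (by linarith)] at h2
  rw [abs_le]
  have := abs_le.1 h1
  constructor <;> linarith

/-- The triangle inequality for the distances encoded by the shift. -/
theorem le_add_of_cosh_eq_shiftPoint {r x s σ τ φ : ℝ} (hr : 0 ≤ r) (hx : 0 ≤ x) (hs : 0 ≤ s)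
    (hσ : 0 ≤ σ) (hτ : 0 ≤ τ) (h1 : Real.cosh σ = shiftPoint (Real.cosh r) (Real.cosh s) φ)
    (h2 : Real.cosh τ = shiftPoint (Real.cosh x) (Real.cosh s) φ) : σ ≤ τ + |r - x| := by
  rw [shiftPoint_cosh hr hs] at h1
  rw [shiftPoint_cosh hx hs] at h2
  -- This is the derivative of cosh τ in x. Since x ↦ cosh τ solves y'' = y, its value at r follows
  -- from y and y' at x; and sinh² τ - w² = sinh² s sin² φ gives |w| ≤ sinh τ.
  set w := Real.sinh x * Real.cosh s - Real.cosh x * Real.sinh s * Real.cos φ with hw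
  have h3 : Real.cosh σ = Real.cosh τ * Real.cosh (r - x) + w * Real.sinh (r - x) := by
    have e1 : Real.cosh r = Real.cosh x * Real.cosh (r - x) + Real.sinh x * Real.sinh (r - x) := by
      rw [← Real.cosh_add]; congr 1; ring
    have e2 : Real.sinh r = Real.sinh x * Real.cosh (r - x) + Real.cosh x * Real.sinh (r - x) := by
      rw [← Real.sinh_add]; congr 1; ring
    rw [h1, h2, e1, e2, hw]; ring
  have h4 : |w| ≤ Real.sinh τ := by
    rw [← Real.sqrt_sq (Real.sinh_nonneg_iff.2 hτ)]
    refine Real.abs_le_sqrt ?_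
    have e3 : Real.sinh τ ^ 2 = w ^ 2 + Real.sinh s ^ 2 * (1 - Real.cos φ ^ 2) := by
      rw [Real.sinh_sq, h2, hw]
      have e4 := Real.cosh_sq x
      have e5 := Real.cosh_sq s
      ring_nf
      rw [e4, e5]
      ring
    have := mul_nonneg (sq_nonneg (Real.sinh s)) (sub_nonneg.2 (Real.cos_sq_le_one φ))
    linarith
  have h5 : Real.cosh σ ≤ Real.cosh (τ + |r - x|) := by
    rw [h3, Real.cosh_add, Real.cosh_abs]
    have : w * Real.sinh (r - x) ≤ |w| * |Real.sinh (r - x)| := by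
      rw [← abs_mul]; exact le_abs_self _
    rw [Real.abs_sinh] at this
    have h6 := mul_le_mul_of_nonneg_right h4 (Real.sinh_nonneg_iff.2 (abs_nonneg (r - x)))
    linarith
  rw [Real.cosh_le_cosh, abs_of_nonneg hσ, abs_of_nonneg (by positivity)] at h5
  exact h5

/-- By the triangle inequality the two distances differ by at most |r - x| ≤ R, and truncation from
below at R is 1-Lipschitz. -/
theorem abs_truncKernel_shiftPoint_sub_le {β R r x s : ℝ} (hβ : 0 ≤ β) (hR : 0 < R)
    (hR1 : R ≤ 1) (hr : 0 ≤ r) (hx : 0 ≤ x) (hs : 0 ≤ s) (hrx : |r - x| ≤ R) (φ : ℝ) :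
    |truncKernel β R (shiftPoint (Real.cosh r) (Real.cosh s) φ) -
        truncKernel β R (shiftPoint (Real.cosh x) (Real.cosh s) φ)| ≤
      β * (2 * Real.cosh 1) ^ (β + 2) *
        kernelMajorant β R (shiftPoint (Real.cosh x) (Real.cosh s) φ) := by
  obtain ⟨σ, hσ, -, h1⟩ := exists_cosh_eq_shiftPoint hr hs φ
  obtain ⟨τ, hτ, -, h2⟩ := exists_cosh_eq_shiftPoint hx hs φ
  have h3 := le_add_of_cosh_eq_shiftPoint hr hx hs hσ hτ h1 h2
  have h4 := le_add_of_cosh_eq_shiftPoint hx hr hs hτ hσ h2 h1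
  rw [abs_sub_comm] at h4
  rw [← h1, ← h2, truncKernel_cosh _ _ hσ, truncKernel_cosh _ _ hτ, kernelMajorant_cosh _ _ hτ]
  refine abs_sinh_rpow_neg_sub_le hβ hR hR1 (le_max_right _ _) (le_max_right _ _) ?_
  refine (abs_max_sub_max_le_abs _ _ _).trans ((abs_le.2 ⟨by linarith, by linarith⟩).trans hrx)

theorem kernelMajorant_nonneg {β R : ℝ} (hR : 0 ≤ R) (y : ℝ) : 0 ≤ kernelMajorant β R y := by
  have : 0 ≤ max √(y ^ 2 - 1) (Real.sinh R) := le_max_of_le_left (Real.sqrt_nonneg _)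
  unfold kernelMajorant
  positivity

/-- The factor 4 cancels the scale 1/4 in the majorant, and coth ≥ 1. -/
theorem indicator_sinh_rpow_le (lam α t : ℝ) :
    (Ioi (1 / 4 : ℝ)).indicator (fun s => Real.sinh s ^ (α - 2 * lam - 1)) t ≤
      4 * kernelMajorant (2 * lam + 1 - α) (1 / 4) (Real.cosh t) := by
  by_cases ht : t ∈ Ioi (1 / 4 : ℝ)
  · have h4 : 1 / 4 < t := ht
    have h0 : 0 < t := by linarith
    have hs : 0 < Real.sinh t := Real.sinh_pos_iff.2 h0
    rw [indicator_of_mem ht, kernelMajorant_cosh _ _ h0.le, max_eq_left h4.le,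
      show α - 2 * lam - 1 = -(2 * lam + 1 - α) by ring]
    have h5 : 1 ≤ Real.cosh t / Real.sinh t := by
      rw [one_le_div hs]; exact (Real.sinh_lt_cosh t).le
    have h6 := Real.rpow_nonneg hs.le (-(2 * lam + 1 - α))
    nlinarith
  · rw [indicator_of_notMem ht]
    have := kernelMajorant_nonneg (β := 2 * lam + 1 - α) (show (0 : ℝ) ≤ 1 / 4 by norm_num)
      (Real.cosh t)
    linarith

/-! ### Means, shifts of constants and pointwise kernel comparison -/

/-- The normalising constant of the generalized shift. -/
noncomputable def shiftConst (lam : ℝ) : ℝ :=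
  Real.Gamma (lam + 1 / 2) / (Real.Gamma (1 / 2) * Real.Gamma lam)

theorem shiftConst_pos {lam : ℝ} (hlam : 0 < lam) : 0 < shiftConst lam :=
  div_pos (Real.Gamma_pos_of_pos (by linarith))
    (mul_pos (Real.Gamma_pos_of_pos (by norm_num)) (Real.Gamma_pos_of_pos hlam))

/-- The part of the kernel removed by the truncation. -/
noncomputable def kernelGap (lam α R y : ℝ) : ENNReal :=
  ‖rieszGegenbauerKernel lam α y - truncKernel (2 * lam + 1 - α) R y‖ₑ

theorem measurable_kernelGap (lam α R : ℝ) : Measurable (kernelGap lam α R) :=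
  ((measurable_rieszGegenbauerKernel lam α).sub (measurable_truncKernel _ R)).enorm

theorem measurable_ofReal_kernelMajorant (β R : ℝ) :
    Measurable fun y => ENNReal.ofReal (kernelMajorant β R y) :=
  (measurable_kernelMajorant β R).ennreal_ofReal

theorem lintegral_enorm_sub_average_le {X : Type*} [MeasurableSpace X] {κ : Measure X}
    [IsFiniteMeasure κ] {u : X → ℂ} (hu : AEStronglyMeasurable u κ) (c : ℂ) :
    ∫⁻ t, ‖u t - ⨍ s, u s ∂κ‖ₑ ∂κ ≤ 2 * ∫⁻ t, ‖u t - c‖ₑ ∂κ := by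
  rcases eq_or_ne κ 0 with h0 | h0
  · simp [h0]
  have hne : NeZero κ := ⟨h0⟩
  -- The infinite case is trivial; otherwise u is integrable, so its average is a genuine one and
  -- not the default value 0.
  rcases eq_or_ne (∫⁻ t, ‖u t - c‖ₑ ∂κ) ⊤ with ht | ht
  · simp [ht]
  have hi : Integrable (fun t => u t - c) κ := ⟨hu.sub aestronglyMeasurable_const, ht.lt_top⟩
  have hui : Integrable u κ := by
    have := hi.add (integrable_const c)
    refine this.congr (Filter.Eventually.of_forall fun t => ?_)
    simp
  have hκ : κ univ ≠ 0 := by simpa using h0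
  have havg : ‖(⨍ s, u s ∂κ) - c‖ₑ ≤ (κ univ)⁻¹ * ∫⁻ t, ‖u t - c‖ₑ ∂κ := by
    have h1 : (⨍ s, u s ∂κ) - c = ∫ s, (u s - c) ∂((κ univ)⁻¹ • κ) := by
      rw [integral_sub (hui.smul_measure (ENNReal.inv_ne_top.2 hκ)) (integrable_const c)]
      simp [average]
    rw [h1]
    refine (enorm_integral_le_lintegral_enorm _).trans (le_of_eq ?_)
    rw [lintegral_smul_measure, smul_eq_mul]
  calc ∫⁻ t, ‖u t - ⨍ s, u s ∂κ‖ₑ ∂κ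
      ≤ ∫⁻ t, (‖u t - c‖ₑ + ‖(⨍ s, u s ∂κ) - c‖ₑ) ∂κ := by
        refine lintegral_mono fun t => ?_
        have : u t - ⨍ s, u s ∂κ = (u t - c) - ((⨍ s, u s ∂κ) - c) := by ring
        rw [this]
        exact enorm_sub_le
    _ = ∫⁻ t, ‖u t - c‖ₑ ∂κ + ‖(⨍ s, u s ∂κ) - c‖ₑ * κ univ := by
        rw [lintegral_add_right _ measurable_const, lintegral_const]
    _ ≤ ∫⁻ t, ‖u t - c‖ₑ ∂κ + (κ univ)⁻¹ * (∫⁻ t, ‖u t - c‖ₑ ∂κ) * κ univ := by gcongr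
    _ = _ := by
        rw [mul_right_comm, ENNReal.inv_mul_cancel hκ (measure_ne_top _ _), one_mul, two_mul]

theorem enorm_gegenbauerShift_sub_le {lam : ℝ} (hlam : 0 < lam) {f : ℝ → ℂ}
    (hf : StronglyMeasurable f) (u v : ℝ) (a : ℂ) :
    ‖gegenbauerShift lam u f v - shiftConst lam • (angleMeasure lam).real univ • a‖ₑ ≤
      ‖shiftConst lam‖ₑ * ∫⁻ φ, ‖f (shiftPoint v u φ) - a‖ₑ ∂(angleMeasure lam) := by
  have := isFiniteMeasure_angleMeasure hlam
  have hC : ‖shiftConst lam‖ₑ ≠ 0 := by simpa using (shiftConst_pos hlam).ne'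
  -- If f is not integrable along the shift, the right side is infinite because the normalising
  -- constant is nonzero; the default value of the integral does no harm.
  rcases eq_or_ne (∫⁻ φ, ‖f (shiftPoint v u φ) - a‖ₑ ∂(angleMeasure lam)) ⊤ with h | h
  · rw [h, ENNReal.mul_top hC]; exact le_top
  have hm : StronglyMeasurable fun φ => f (shiftPoint v u φ) :=
    hf.comp_measurable (measurable_shiftPoint_angle v u)
  have hi : Integrable (fun φ => f (shiftPoint v u φ) - a) (angleMeasure lam) :=
    ⟨(hm.sub stronglyMeasurable_const).aestronglyMeasurable, h.lt_top⟩
  have hfi : Integrable (fun φ => f (shiftPoint v u φ)) (angleMeasure lam) := by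
    refine (hi.add (integrable_const a)).congr (Filter.Eventually.of_forall fun t => ?_)
    simp
  rw [gegenbauerShift_eq, ← shiftConst, ← smul_sub, enorm_smul, ← integral_const,
    ← integral_sub hfi (integrable_const a)]
  gcongr
  exact enorm_integral_le_lintegral_enorm _

theorem integrable_truncKernel_shiftPoint {lam β R : ℝ} (hlam : 0 < lam) (hβ : 0 ≤ β)
    (hR : 0 < R) (u v : ℝ) :
    Integrable (fun φ => truncKernel β R (shiftPoint v u φ)) (angleMeasure lam) := by
  have := isFiniteMeasure_angleMeasure hlam
  refine Integrable.of_bound ((measurable_truncKernel β R).comp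
    (measurable_shiftPoint_angle v u)).aestronglyMeasurable (Real.sinh R ^ (-β))
    (Filter.Eventually.of_forall fun φ => ?_)
  rw [Real.norm_of_nonneg (truncKernel_nonneg _)]
  exact truncKernel_le hβ hR _

/-- For s ≠ r the shift point is at least cosh(r - s) > 1, so the kernel is bounded in φ. The
excluded s forms a null set. -/
theorem integrable_kernel_shiftPoint {lam α r s : ℝ} (hlam : 0 < lam) (hα' : α < 2 * lam + 1)
    (hr : 0 ≤ r) (hs : 0 ≤ s) (hrs : s ≠ r) :
    Integrable (fun φ => rieszGegenbauerKernel lam α (shiftPoint (Real.cosh r) (Real.cosh s) φ))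
      (angleMeasure lam) := by
  have := isFiniteMeasure_angleMeasure hlam
  refine Integrable.of_bound ((measurable_rieszGegenbauerKernel lam α).comp
    (measurable_shiftPoint_angle _ _)).aestronglyMeasurable
    (Real.sinh |r - s| ^ (α - 2 * lam - 1)) (Filter.Eventually.of_forall fun φ => ?_)
  have h1 := cosh_sub_le_shiftPoint hr hs φ
  have hpos : 0 < |r - s| := abs_pos.2 (sub_ne_zero.2 hrs.symm)
  have h2 : Real.sinh |r - s| ≤ √(shiftPoint (Real.cosh r) (Real.cosh s) φ ^ 2 - 1) := by
    rw [← sqrt_cosh_sq_sub_one hpos.le, Real.cosh_abs]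
    have := Real.one_le_cosh (r - s)
    gcongr
  rw [rieszGegenbauerKernel, Real.norm_of_nonneg (Real.rpow_nonneg (Real.sqrt_nonneg _) _)]
  exact Real.rpow_le_rpow_of_nonpos (Real.sinh_pos_iff.2 hpos) h2 (by linarith)

theorem enorm_shift_kernel_sub_le {lam α R r x s : ℝ} (hlam : 0 < lam) (hα' : α < 2 * lam + 1)
    (hR : 0 < R) (hr : 0 ≤ r) (hs : 0 ≤ s) (hrs : s ≠ r) :
    ‖gegenbauerShift lam (Real.cosh s) (rieszGegenbauerKernel lam α) (Real.cosh r) -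
        gegenbauerShift lam (Real.cosh s) (truncKernel (2 * lam + 1 - α) R) (Real.cosh x)‖ₑ ≤
      ‖shiftConst lam‖ₑ *
        (∫⁻ φ, kernelGap lam α R (shiftPoint (Real.cosh r) (Real.cosh s) φ) ∂(angleMeasure lam) +
          ∫⁻ φ, ‖truncKernel (2 * lam + 1 - α) R (shiftPoint (Real.cosh r) (Real.cosh s) φ) -
            truncKernel (2 * lam + 1 - α) R (shiftPoint (Real.cosh x) (Real.cosh s) φ)‖ₑ
              ∂(angleMeasure lam)) := by
  rw [gegenbauerShift_eq, gegenbauerShift_eq, ← shiftConst, ← smul_sub, enorm_smul,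
    ← integral_sub (integrable_kernel_shiftPoint hlam hα' hr hs hrs)
      (integrable_truncKernel_shiftPoint hlam (by linarith) hR _ _)]
  have hg : Measurable fun φ => kernelGap lam α R (shiftPoint (Real.cosh r) (Real.cosh s) φ) :=
    (measurable_kernelGap lam α R).comp (measurable_shiftPoint_angle _ _)
  rw [← lintegral_add_left hg]
  gcongr
  refine (enorm_integral_le_lintegral_enorm _).trans (lintegral_mono fun φ => ?_)
  rw [← sub_add_sub_cancel _
    (truncKernel (2 * lam + 1 - α) R (shiftPoint (Real.cosh r) (Real.cosh s) φ))]
  exact enorm_add_le _ _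

/-! ### Convolution bounds at scale min(d, 1) -/

theorem shiftConv_kernelMajorant_le {lam α p q : ℝ} (hlam : 0 < lam) (hpq : p.HolderConjugate q)
    (hβq : (2 * lam + 1 - α) * q = 2 * lam + 1) :
    ∃ C : ENNReal, C < ⊤ ∧ ∀ R, 0 < R → R ≤ 1 → ∀ h : ℝ → ENNReal, Measurable h →
      ∀ x, 0 ≤ x →
        shiftConv lam (fun y => ENNReal.ofReal (kernelMajorant (2 * lam + 1 - α) R y)) h
          (Real.cosh x) ≤ C * (∫⁻ t, h t ^ p ∂(gegenbauerMeasure lam)) ^ (1 / p) := by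
  have := isFiniteMeasure_angleMeasure hlam
  have hp := hpq.pos
  have hq := hpq.symm.pos
  have hM := measure_lt_top (angleMeasure lam) univ
  refine ⟨(angleMeasure lam univ * ENNReal.ofReal
    (Real.cosh 1 ^ q / (2 * lam + 1) + Real.cosh 1 ^ (q - 1))) ^ (1 / q) *
      angleMeasure lam univ ^ (1 / p), ?_, ?_⟩
  · exact ENNReal.mul_lt_top (ENNReal.rpow_lt_top_of_nonneg (by positivity)
      (ENNReal.mul_lt_top hM ENNReal.ofReal_lt_top).ne)
      (ENNReal.rpow_lt_top_of_nonneg (by positivity) hM.ne)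
  · intro R hR hR1 h hh x hx
    refine (shiftConv_le lam hpq.symm (measurable_ofReal_kernelMajorant _ R) hh hx).trans ?_
    rw [mul_assoc, ← ENNReal.mul_rpow_of_nonneg _ _ (by positivity)]
    gcongr
    exact lintegral_kernelMajorant_rpow_le hlam hpq.symm.lt.le hβq hR hR1

theorem lintegral_truncKernel_sub_le {lam α p q : ℝ} (hlam : 0 < lam) (hα' : α < 2 * lam + 1)
    (hpq : p.HolderConjugate q) (hβq : (2 * lam + 1 - α) * q = 2 * lam + 1) :
    ∃ C : ENNReal, C < ⊤ ∧ ∀ d, 0 < d → ∀ h : ℝ → ENNReal, Measurable h →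
      ∀ r x, 0 ≤ r → 0 ≤ x → |r - x| ≤ d →
        ∫⁻ s, (∫⁻ φ,
          ‖truncKernel (2 * lam + 1 - α) (min d 1) (shiftPoint (Real.cosh r) (Real.cosh s) φ) -
            truncKernel (2 * lam + 1 - α) (min d 1) (shiftPoint (Real.cosh x) (Real.cosh s) φ)‖ₑ
              ∂(angleMeasure lam)) * h s ∂(gegenbauerMeasure lam) ≤
          C * (∫⁻ t, h t ^ p ∂(gegenbauerMeasure lam)) ^ (1 / p) := by
  obtain ⟨B, hB, hBle⟩ := shiftConv_kernelMajorant_le (α := α) hlam hpq hβq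
  set β := 2 * lam + 1 - α with hβ
  have hβ0 : 0 ≤ β := by linarith
  set L := ENNReal.ofReal (β * (2 * Real.cosh 1) ^ (β + 2)) with hL
  refine ⟨(L + 2) * B, ENNReal.mul_lt_top (ENNReal.add_lt_top.2
    ⟨ENNReal.ofReal_lt_top, ENNReal.ofNat_lt_top⟩) hB, ?_⟩
  intro d hd h hh r x hr hx hrx
  set N := (∫⁻ t, h t ^ p ∂(gegenbauerMeasure lam)) ^ (1 / p)
  -- For d ≤ 1 the oscillation estimate is used, with constant L. For d ≥ 1 each of the two terms is
  -- bounded separately by the majorant at scale 1, whence the 2.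
  rcases le_total d 1 with h1 | h1
  · rw [min_eq_left h1]
    have key : ∀ s, 0 < s → (∫⁻ φ, ‖truncKernel β d (shiftPoint (Real.cosh r) (Real.cosh s) φ) -
            truncKernel β d (shiftPoint (Real.cosh x) (Real.cosh s) φ)‖ₑ ∂(angleMeasure lam)) ≤
        L * ∫⁻ φ, ENNReal.ofReal (kernelMajorant β d (shiftPoint (Real.cosh x) (Real.cosh s) φ))
          ∂(angleMeasure lam) := by
      intro s hs
      rw [← lintegral_const_mul' _ _ ENNReal.ofReal_ne_top]
      refine lintegral_mono fun φ => ?_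
      rw [← ENNReal.ofReal_mul (by have := Real.cosh_pos 1; positivity),
        Real.enorm_eq_ofReal_abs]
      exact ENNReal.ofReal_le_ofReal
        (abs_truncKernel_shiftPoint_sub_le hβ0 hd h1 hr hx hs.le hrx φ)
    calc _ ≤ ∫⁻ s, L * ((∫⁻ φ, ENNReal.ofReal
            (kernelMajorant β d (shiftPoint (Real.cosh x) (Real.cosh s) φ))
              ∂(angleMeasure lam)) * h s) ∂(gegenbauerMeasure lam) := by
          refine lintegral_mono_ae ?_
          filter_upwards [ae_gegenbauerMeasure_pos lam] with s hs
          rw [← mul_assoc]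
          gcongr
          exact key s hs
      _ = L * shiftConv lam (fun y => ENNReal.ofReal (kernelMajorant β d y)) h (Real.cosh x) :=
          lintegral_const_mul' _ _ ENNReal.ofReal_ne_top
      _ ≤ L * (B * N) := by gcongr; exact hBle d hd h1 h hh x hx
      _ ≤ _ := by rw [← mul_assoc]; gcongr; exact le_self_add
  · rw [min_eq_right h1]
    have hmaj : ∀ y, ‖truncKernel β 1 y‖ₑ ≤ ENNReal.ofReal (kernelMajorant β 1 y) := by
      intro y
      rw [Real.enorm_eq_ofReal (truncKernel_nonneg y)]
      exact ENNReal.ofReal_le_ofReal (truncKernel_one_le_kernelMajorant β y)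
    have hm := measurable_ofReal_kernelMajorant β 1
    calc _ ≤ ∫⁻ s, ((∫⁻ φ, ENNReal.ofReal
            (kernelMajorant β 1 (shiftPoint (Real.cosh r) (Real.cosh s) φ))
              ∂(angleMeasure lam)) * h s + (∫⁻ φ, ENNReal.ofReal
            (kernelMajorant β 1 (shiftPoint (Real.cosh x) (Real.cosh s) φ))
              ∂(angleMeasure lam)) * h s) ∂(gegenbauerMeasure lam) := by
          refine lintegral_mono fun s => ?_
          rw [← add_mul]
          gcongr
          have hmr : Measurable fun φ => ENNReal.ofReal
              (kernelMajorant β 1 (shiftPoint (Real.cosh r) (Real.cosh s) φ)) :=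
            hm.comp (measurable_shiftPoint_angle _ _)
          rw [← lintegral_add_left hmr]
          exact lintegral_mono fun φ => enorm_sub_le.trans (add_le_add (hmaj _) (hmaj _))
      _ = shiftConv lam (fun y => ENNReal.ofReal (kernelMajorant β 1 y)) h (Real.cosh r) +
          shiftConv lam (fun y => ENNReal.ofReal (kernelMajorant β 1 y)) h (Real.cosh x) :=
          lintegral_add_left ((measurable_lintegral_shiftPoint lam _ hm).mul hh) _
      _ ≤ B * N + B * N := add_le_add (hBle 1 one_pos le_rfl h hh r hr)
          (hBle 1 one_pos le_rfl h hh x hx)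
      _ = 2 * B * N := by ring
      _ ≤ _ := by gcongr; exact le_add_self

theorem lintegral_kernelGap_le {lam α : ℝ} (hα : 0 < α) (hα' : α < 2 * lam + 1) {R : ℝ}
    (hR : 0 < R) :
    ∫⁻ t, kernelGap lam α R (Real.cosh t) ∂(gegenbauerMeasure lam) ≤
      ENNReal.ofReal (Real.sinh R ^ α / α) :=
  lintegral_kernel_sub_truncKernel_le hα hα' hR

theorem lintegral_shiftConv_kernelGap_lt_top {lam α p q : ℝ} (hlam : 0 < lam) (hα : 0 < α)
    (hα' : α < 2 * lam + 1) (hpq : p.HolderConjugate q) {R : ℝ} (hR : 0 < R)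
    {h : ℝ → ENNReal} (hh : Measurable h)
    (hfin : ∫⁻ t, h t ^ p ∂(gegenbauerMeasure lam) < ⊤) :
    ∫⁻ r, shiftConv lam (kernelGap lam α R) h (Real.cosh r) ^ p ∂(gegenbauerMeasure lam) < ⊤ := by
  have := isFiniteMeasure_angleMeasure hlam
  refine (lintegral_shiftConv_rpow_le hpq (measurable_kernelGap lam α R) hh).trans_lt
    (ENNReal.mul_lt_top (ENNReal.rpow_lt_top_of_nonneg hpq.pos.le ?_) hfin)
  exact (ENNReal.mul_lt_top (measure_lt_top _ _)
    ((lintegral_kernelGap_le hα hα' hR).trans_lt ENNReal.ofReal_lt_top)).ne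

theorem ae_shiftConv_kernelGap_lt_top {lam α p q : ℝ} (hlam : 0 < lam) (hα : 0 < α)
    (hα' : α < 2 * lam + 1) (hpq : p.HolderConjugate q) {R : ℝ} (hR : 0 < R)
    {h : ℝ → ENNReal} (hh : Measurable h)
    (hfin : ∫⁻ t, h t ^ p ∂(gegenbauerMeasure lam) < ⊤) :
    ∀ᵐ r ∂(gegenbauerMeasure lam), shiftConv lam (kernelGap lam α R) h (Real.cosh r) < ⊤ := by
  have hm : Measurable fun r => shiftConv lam (kernelGap lam α R) h (Real.cosh r) ^ p :=
    ((measurable_shiftConv lam (measurable_kernelGap lam α R) hh).comp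
      Real.measurable_cosh).pow_const p
  filter_upwards [ae_lt_top hm
    (lintegral_shiftConv_kernelGap_lt_top hlam hα hα' hpq hR hh hfin).ne] with r hr
  exact (ENNReal.rpow_lt_top_iff_of_pos hpq.pos).1 hr

/-- Hölder on the ball gives μ(H)^{1/q}. Young gives the L¹ norm of the gap, at most sinh^α R / α,
and α = (2λ+1)/p turns this into a multiple of μ(H)^{1/p}. The two powers multiply to μ(H). -/
theorem setLIntegral_shiftConv_kernelGap_le {lam α p q : ℝ} (hlam : 0 < lam) (hα : 0 < α)
    (hα' : α < 2 * lam + 1) (hpα : p * α = 2 * lam + 1) (hpq : p.HolderConjugate q) :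
    ∃ C : ENNReal, C < ⊤ ∧ ∀ d, 0 < d → ∀ h : ℝ → ENNReal, Measurable h → ∀ x, 0 ≤ x →
      ∫⁻ t in gegenbauerInterval 0 d, ∫⁻ φ, shiftConv lam (kernelGap lam α (min d 1)) h
          (shiftPoint (Real.cosh x) (Real.cosh t) φ) ∂(angleMeasure lam)
            ∂(gegenbauerMeasure lam) ≤
        C * (∫⁻ t, h t ^ p ∂(gegenbauerMeasure lam)) ^ (1 / p) *
          gegenbauerMeasure lam (gegenbauerInterval 0 d) := by
  have := isFiniteMeasure_angleMeasure hlam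
  have hp := hpq.pos
  have hq := hpq.symm.pos
  have hsum : 1 / p + 1 / q = 1 := by
    have := hpq.inv_add_inv_eq_one
    simpa using this
  have hM := measure_lt_top (angleMeasure lam) univ
  set M := angleMeasure lam univ with hMdef
  set Q := 2 * lam + 1 with hQdef
  have hQ : 0 < Q := by linarith
  set CK := ENNReal.ofReal (1 / α) * (ENNReal.ofReal Q * ENNReal.ofReal (Real.cosh 1)) ^ (1 / p)
    with hCK
  refine ⟨M * M * CK, ?_, ?_⟩
  · exact ENNReal.mul_lt_top (ENNReal.mul_lt_top hM hM) (ENNReal.mul_lt_top ENNReal.ofReal_lt_top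
      (ENNReal.rpow_lt_top_of_nonneg (by positivity)
        (ENNReal.mul_lt_top ENNReal.ofReal_lt_top ENNReal.ofReal_lt_top).ne))
  intro d hd h hh x hx
  set μH := gegenbauerMeasure lam (gegenbauerInterval 0 d) with hμH
  set R := min d 1 with hR
  have hR0 : 0 < R := lt_min hd one_pos
  have hsR : 0 < Real.sinh R := Real.sinh_pos_iff.2 hR0
  have hK : ∫⁻ t, kernelGap lam α R (Real.cosh t) ∂(gegenbauerMeasure lam) ≤
      CK * μH ^ (1 / p) := by
    refine (lintegral_kernelGap_le hα hα' hR0).trans ?_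
    have h1 := le_gegenbauerMeasure_interval hlam hR0 (min_le_right _ _) (min_le_left d 1)
    have h2 : ENNReal.ofReal (Real.sinh R ^ Q) ≤
        ENNReal.ofReal Q * ENNReal.ofReal (Real.cosh 1) * μH := by
      calc ENNReal.ofReal (Real.sinh R ^ Q)
          = ENNReal.ofReal Q * ENNReal.ofReal (Real.sinh R ^ Q / Q) := by
            rw [← ENNReal.ofReal_mul hQ.le, mul_div_cancel₀ _ hQ.ne']
        _ ≤ ENNReal.ofReal Q * (ENNReal.ofReal (Real.cosh 1) * μH) := by gcongr
        _ = _ := by rw [mul_assoc]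
    have h3 : ENNReal.ofReal (Real.sinh R ^ α) = ENNReal.ofReal (Real.sinh R ^ Q) ^ (1 / p) := by
      rw [ENNReal.ofReal_rpow_of_nonneg (by positivity) (by positivity),
        ← Real.rpow_mul hsR.le, ← hpα]
      congr 2
      field_simp
    rw [div_eq_mul_one_div, mul_comm, ENNReal.ofReal_mul (by positivity), h3, hCK, mul_assoc,
      ← ENNReal.mul_rpow_of_nonneg _ _ (by positivity)]
    gcongr
  refine (setLIntegral_shiftPoint_le lam hpq
    (measurable_shiftConv lam (measurable_kernelGap lam α R) hh)
    (s := gegenbauerInterval 0 d) (measurableSet_Ioo.inter measurableSet_Ici) hx).trans ?_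
  have hY := lintegral_shiftConv_rpow_le hpq (measurable_kernelGap lam α R) hh (lam := lam)
  calc _ ≤ (M * ((M * (CK * μH ^ (1 / p))) ^ p * ∫⁻ t, h t ^ p ∂(gegenbauerMeasure lam))) ^ (1 / p)
        * (M * μH) ^ (1 / q) := by
        gcongr
        refine hY.trans ?_
        gcongr
    _ = M ^ (1 / p) * (M * (CK * μH ^ (1 / p))) *
        (∫⁻ t, h t ^ p ∂(gegenbauerMeasure lam)) ^ (1 / p) * (M ^ (1 / q) * μH ^ (1 / q)) := by
        rw [ENNReal.mul_rpow_of_nonneg _ _ (by positivity : 0 ≤ 1 / p),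
          ENNReal.mul_rpow_of_nonneg _ _ (by positivity : 0 ≤ 1 / p),
          ENNReal.mul_rpow_of_nonneg _ _ (by positivity : 0 ≤ 1 / q), ← ENNReal.rpow_mul,
          mul_one_div_cancel hp.ne', ENNReal.rpow_one]
        ring
    _ = (M ^ (1 / p) * M ^ (1 / q)) * M * CK *
        (∫⁻ t, h t ^ p ∂(gegenbauerMeasure lam)) ^ (1 / p) * (μH ^ (1 / p) * μH ^ (1 / q)) := by
        ring
    _ = _ := by
        rw [← ENNReal.rpow_add_of_nonneg _ _ (by positivity) (by positivity),
          ← ENNReal.rpow_add_of_nonneg _ _ (by positivity) (by positivity), hsum,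
          ENNReal.rpow_one, ENNReal.rpow_one]

/-! ### Measurability and absolute convergence -/

theorem stronglyMeasurable_gegenbauerShift {E : Type*} [NormedAddCommGroup E] [NormedSpace ℝ E]
    (lam : ℝ) {f : ℝ → E} (hf : StronglyMeasurable f) :
    StronglyMeasurable fun z : ℝ × ℝ => gegenbauerShift lam (Real.cosh z.2) f z.1 := by
  have hm : Measurable fun z : (ℝ × ℝ) × ℝ => shiftPoint z.1.1 (Real.cosh z.1.2) z.2 := by
    unfold shiftPoint; fun_prop
  simp only [gegenbauerShift_eq]
  exact (hf.comp_measurable hm).integral_prod_right'.const_smul _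

theorem stronglyMeasurable_gegenbauerShift_right {E : Type*} [NormedAddCommGroup E]
    [NormedSpace ℝ E] (lam : ℝ) {f : ℝ → E} (hf : StronglyMeasurable f) (y : ℝ) :
    StronglyMeasurable fun t => gegenbauerShift lam (Real.cosh t) f y := by
  simp only [gegenbauerShift_eq]
  exact (hf.comp_measurable (measurable_shiftPoint_right y)).integral_prod_right'.const_smul _

/-- The factor in front of `f` in the modified fractional integral. -/
noncomputable def modifiedWeight (lam α y t : ℝ) : ℝ :=
  gegenbauerShift lam (Real.cosh t) (rieszGegenbauerKernel lam α) y -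
    (Ioi (1 / 4 : ℝ)).indicator (fun s => Real.sinh s ^ (α - 2 * lam - 1)) t

theorem measurable_indicator_sinh (a : ℝ) :
    Measurable ((Ioi (1 / 4 : ℝ)).indicator (fun s => Real.sinh s ^ a)) :=
  (Real.measurable_sinh.pow_const a).indicator measurableSet_Ioi

theorem measurable_modifiedWeight (lam α : ℝ) :
    Measurable fun z : ℝ × ℝ => modifiedWeight lam α z.1 z.2 :=
  (stronglyMeasurable_gegenbauerShift lam
    (measurable_rieszGegenbauerKernel lam α).stronglyMeasurable).measurable.sub
    ((measurable_indicator_sinh _).comp measurable_snd)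

theorem measurable_modifiedWeight_right (lam α y : ℝ) : Measurable (modifiedWeight lam α y) :=
  Measurable.of_uncurry_left (f := modifiedWeight lam α) (measurable_modifiedWeight lam α)

theorem stronglyMeasurable_integral_modifiedWeight (lam α : ℝ) {g : ℝ → ℂ}
    (hg : StronglyMeasurable g) :
    StronglyMeasurable fun y => ∫ t, modifiedWeight lam α y t • g t ∂(gegenbauerMeasure lam) :=
  ((measurable_modifiedWeight lam α).stronglyMeasurable.smul
    (hg.comp_measurable measurable_snd)).integral_prod_right'

theorem integrable_modifiedWeight_smul {lam α p q : ℝ} (hlam : 0 < lam)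
    (hpq : p.HolderConjugate q) (hβq : (2 * lam + 1 - α) * q = 2 * lam + 1) {g : ℝ → ℂ}
    (hg : StronglyMeasurable g) (hfin : ∫⁻ t, ‖g t‖ₑ ^ p ∂(gegenbauerMeasure lam) < ⊤) {r : ℝ}
    (hr : 0 ≤ r)
    (hE : shiftConv lam (kernelGap lam α 1) (fun t => ‖g t‖ₑ) (Real.cosh r) < ⊤) :
    Integrable (fun t => modifiedWeight lam α (Real.cosh r) t • g t)
      (gegenbauerMeasure lam) := by
  have hp := hpq.pos
  have hq := hpq.symm.pos
  obtain ⟨B, hB, hBle⟩ := shiftConv_kernelMajorant_le (α := α) hlam hpq hβq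
  set β := 2 * lam + 1 - α with hβ
  have hh : Measurable fun t => ‖g t‖ₑ := hg.measurable.enorm
  have hw := measurable_modifiedWeight_right lam α (Real.cosh r)
  refine ⟨(hw.stronglyMeasurable.smul hg).aestronglyMeasurable, ?_⟩
  rw [hasFiniteIntegral_iff_enorm]
  have hmaj1 := measurable_ofReal_kernelMajorant β 1
  have hmaj4 := measurable_ofReal_kernelMajorant β (1 / 4)
  have hgap := measurable_kernelGap lam α 1
  have hgapr : Measurable fun t => ∫⁻ φ, kernelGap lam α 1
      (shiftPoint (Real.cosh r) (Real.cosh t) φ) ∂(angleMeasure lam) :=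
    measurable_lintegral_shiftPoint lam _ hgap
  have hmajr : Measurable fun t => ∫⁻ φ, ENNReal.ofReal (kernelMajorant β 1
      (shiftPoint (Real.cosh r) (Real.cosh t) φ)) ∂(angleMeasure lam) :=
    measurable_lintegral_shiftPoint lam _ hmaj1
  have hind : ∫⁻ t, ENNReal.ofReal (kernelMajorant β (1 / 4) (Real.cosh t)) * ‖g t‖ₑ
      ∂(gegenbauerMeasure lam) < ⊤ := by
    refine (ENNReal.lintegral_mul_le_Lp_mul_Lq _ hpq.symm
      (hmaj4.comp Real.measurable_cosh).aemeasurable hh.aemeasurable).trans_lt ?_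
    refine ENNReal.mul_lt_top (ENNReal.rpow_lt_top_of_nonneg (by positivity) ?_)
      (ENNReal.rpow_lt_top_of_nonneg (by positivity) hfin.ne)
    exact ((lintegral_kernelMajorant_rpow_le hlam hpq.symm.lt.le hβq (by norm_num)
      (by norm_num)).trans_lt ENNReal.ofReal_lt_top).ne
  have hconv : shiftConv lam (fun y => ENNReal.ofReal (kernelMajorant β 1 y))
      (fun t => ‖g t‖ₑ) (Real.cosh r) < ⊤ :=
    (hBle 1 one_pos le_rfl _ hh r hr).trans_lt
      (ENNReal.mul_lt_top hB (ENNReal.rpow_lt_top_of_nonneg (by positivity) hfin.ne))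
  -- Three pieces: the gap at scale 1, finite at r by assumption; the kernel truncated at 1 and the
  -- indicator term, both dominated by majorants in L^q and paired with g in L^p.
  have hbound : ∀ t, ‖modifiedWeight lam α (Real.cosh r) t • g t‖ₑ ≤
      ‖shiftConst lam‖ₑ * ((∫⁻ φ, kernelGap lam α 1
        (shiftPoint (Real.cosh r) (Real.cosh t) φ) ∂(angleMeasure lam)) * ‖g t‖ₑ +
      (∫⁻ φ, ENNReal.ofReal (kernelMajorant β 1
        (shiftPoint (Real.cosh r) (Real.cosh t) φ)) ∂(angleMeasure lam)) * ‖g t‖ₑ) +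
      ENNReal.ofReal 4 * (ENNReal.ofReal (kernelMajorant β (1 / 4) (Real.cosh t)) * ‖g t‖ₑ) := by
    intro t
    rw [enorm_smul, ← add_mul, ← mul_assoc, ← mul_assoc, ← add_mul]
    gcongr
    refine enorm_sub_le.trans (add_le_add ?_ ?_)
    · have hgapφ : Measurable fun φ => kernelGap lam α 1
          (shiftPoint (Real.cosh r) (Real.cosh t) φ) :=
        hgap.comp (measurable_shiftPoint_angle _ _)
      rw [gegenbauerShift_eq, ← shiftConst, enorm_smul, ← lintegral_add_left hgapφ]
      gcongr
      refine (enorm_integral_le_lintegral_enorm _).trans (lintegral_mono fun φ => ?_)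
      rw [← sub_add_cancel (rieszGegenbauerKernel lam α _)
        (truncKernel β 1 (shiftPoint (Real.cosh r) (Real.cosh t) φ))]
      refine (enorm_add_le _ _).trans (add_le_add le_rfl ?_)
      rw [Real.enorm_eq_ofReal (truncKernel_nonneg _)]
      exact ENNReal.ofReal_le_ofReal (truncKernel_one_le_kernelMajorant _ _)
    · rw [← ENNReal.ofReal_mul (by norm_num), Real.enorm_eq_ofReal]
      · exact ENNReal.ofReal_le_ofReal (indicator_sinh_rpow_le lam α t)
      · refine indicator_nonneg (fun s hs => Real.rpow_nonneg (Real.sinh_nonneg_iff.2 ?_) _) t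
        have : 1 / 4 < s := hs
        linarith
  refine (lintegral_mono hbound).trans_lt ?_
  have hm4 : Measurable fun t => ENNReal.ofReal 4 *
      (ENNReal.ofReal (kernelMajorant β (1 / 4) (Real.cosh t)) * ‖g t‖ₑ) :=
    ((hmaj4.comp Real.measurable_cosh).mul hh).const_mul _
  have hm1 : Measurable fun t => (∫⁻ φ, ENNReal.ofReal (kernelMajorant β 1
      (shiftPoint (Real.cosh r) (Real.cosh t) φ)) ∂(angleMeasure lam)) * ‖g t‖ₑ := hmajr.mul hh
  rw [lintegral_add_right _ hm4, lintegral_const_mul' _ _ enorm_ne_top,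
    lintegral_const_mul' _ _ ENNReal.ofReal_ne_top, lintegral_add_right _ hm1]
  exact ENNReal.add_lt_top.2 ⟨ENNReal.mul_lt_top enorm_lt_top (ENNReal.add_lt_top.2 ⟨hE, hconv⟩),
    ENNReal.mul_lt_top ENNReal.ofReal_lt_top hind⟩

/-! ### Oscillation of the fractional integral -/

theorem exists_enorm_integral_sub_le {lam α p q : ℝ} (hlam : 0 < lam) (hα' : α < 2 * lam + 1)
    (hpq : p.HolderConjugate q) (hβq : (2 * lam + 1 - α) * q = 2 * lam + 1) :
    ∃ C : ENNReal, C < ⊤ ∧ ∀ g : ℝ → ℂ, StronglyMeasurable g →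
      ∫⁻ t, ‖g t‖ₑ ^ p ∂(gegenbauerMeasure lam) < ⊤ → ∀ d, 0 < d → ∀ x, 0 ≤ x → ∃ a : ℂ,
        ∀ r, 0 ≤ r → |r - x| ≤ d →
          shiftConv lam (kernelGap lam α 1) (fun t => ‖g t‖ₑ) (Real.cosh r) < ⊤ →
          ‖(∫ t, modifiedWeight lam α (Real.cosh r) t • g t ∂(gegenbauerMeasure lam)) - a‖ₑ ≤
            ‖shiftConst lam‖ₑ *
              (shiftConv lam (kernelGap lam α (min d 1)) (fun t => ‖g t‖ₑ) (Real.cosh r) +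
                C * (∫⁻ t, ‖g t‖ₑ ^ p ∂(gegenbauerMeasure lam)) ^ (1 / p)) := by
  have hp := hpq.pos
  obtain ⟨C, hC, hCle⟩ := lintegral_truncKernel_sub_le hlam hα' hpq hβq
  refine ⟨C, hC, fun g hg hfin d hd x hx => ?_⟩
  set R := min d 1 with hRdef
  have hR : 0 < R := lt_min hd one_pos
  -- The comparison constant is the integral with the kernel truncated and centred at x. It keeps
  -- the indicator term, which therefore cancels, and it does not depend on r.
  set T : ℝ → ℝ := fun t =>
    gegenbauerShift lam (Real.cosh t) (truncKernel (2 * lam + 1 - α) R) (Real.cosh x) -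
      (Ioi (1 / 4 : ℝ)).indicator (fun s => Real.sinh s ^ (α - 2 * lam - 1)) t with hT
  refine ⟨∫ t, T t • g t ∂(gegenbauerMeasure lam), fun r hr hrx hE1 => ?_⟩
  have hC0 : ‖shiftConst lam‖ₑ ≠ 0 := by simpa using (shiftConst_pos hlam).ne'
  have hh : Measurable fun t => ‖g t‖ₑ := hg.measurable.enorm
  set N := (∫⁻ t, ‖g t‖ₑ ^ p ∂(gegenbauerMeasure lam)) ^ (1 / p) with hN
  have hNtop : N < ⊤ := ENNReal.rpow_lt_top_of_nonneg (by positivity) hfin.ne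
  rcases eq_or_ne (shiftConv lam (kernelGap lam α R) (fun t => ‖g t‖ₑ) (Real.cosh r)) ⊤ with
    hE | hE
  · rw [hE, top_add, ENNReal.mul_top hC0]; exact le_top
  have hi := integrable_modifiedWeight_smul hlam hpq hβq hg hfin hr hE1
  have hTm : Measurable T := by
    have h1 := (stronglyMeasurable_gegenbauerShift_right lam
      (measurable_truncKernel (2 * lam + 1 - α) R).stronglyMeasurable (Real.cosh x)).measurable
    exact h1.sub (measurable_indicator_sinh _)
  have hwm := measurable_modifiedWeight_right lam α (Real.cosh r)
  have hgapr : Measurable fun t => (∫⁻ φ, kernelGap lam α R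
      (shiftPoint (Real.cosh r) (Real.cosh t) φ) ∂(angleMeasure lam)) * ‖g t‖ₑ :=
    (measurable_lintegral_shiftPoint lam _ (measurable_kernelGap lam α R)).mul hh
  have hdiff : ∫⁻ t, ‖(modifiedWeight lam α (Real.cosh r) t - T t) • g t‖ₑ
      ∂(gegenbauerMeasure lam) ≤ ‖shiftConst lam‖ₑ *
        (shiftConv lam (kernelGap lam α R) (fun t => ‖g t‖ₑ) (Real.cosh r) + C * N) := by
    refine le_trans ?_ (mul_le_mul' le_rfl
      (add_le_add le_rfl (hCle d hd _ hh r x hr hx hrx)))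
    rw [shiftConv, ← lintegral_add_left hgapr,
      ← lintegral_const_mul' _ _ enorm_ne_top]
    refine lintegral_mono_ae ?_
    filter_upwards [ae_gegenbauerMeasure_pos lam, ae_gegenbauerMeasure_ne lam r] with t ht htr
    rw [enorm_smul, ← add_mul, ← mul_assoc, modifiedWeight, hT, sub_sub_sub_cancel_right]
    gcongr
    exact enorm_shift_kernel_sub_le hlam hα' hR hr ht.le htr
  have hid : Integrable (fun t => (modifiedWeight lam α (Real.cosh r) t - T t) • g t)
      (gegenbauerMeasure lam) :=
    ⟨((hwm.sub hTm).stronglyMeasurable.smul hg).aestronglyMeasurable,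
      hdiff.trans_lt (ENNReal.mul_lt_top enorm_lt_top
        (ENNReal.add_lt_top.2 ⟨hE.lt_top, ENNReal.mul_lt_top hC hNtop⟩))⟩
  -- Integrability of T g is inherited from the full weight at r and from the difference just
  -- bounded.
  have hiT : Integrable (fun t => T t • g t) (gegenbauerMeasure lam) := by
    refine (hi.sub hid).congr (Filter.Eventually.of_forall fun t => ?_)
    simp only [Pi.sub_apply, ← sub_smul, sub_sub_cancel]
  rw [← integral_sub hi hiT]
  simp only [← sub_smul]
  exact (enorm_integral_le_lintegral_enorm _).trans hdiff

theorem exists_setLIntegral_enorm_shift_sub_le {lam α p q : ℝ} (hlam : 0 < lam) (hα : 0 < α)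
    (hα' : α < 2 * lam + 1) (hpα : p * α = 2 * lam + 1) (hpq : p.HolderConjugate q)
    (hβq : (2 * lam + 1 - α) * q = 2 * lam + 1) :
    ∃ C : ENNReal, C < ⊤ ∧ ∀ g : ℝ → ℂ, StronglyMeasurable g →
      ∫⁻ t, ‖g t‖ₑ ^ p ∂(gegenbauerMeasure lam) < ⊤ → ∀ d, 0 < d → ∀ x, 0 ≤ x → ∃ c : ℂ,
        ∫⁻ t in gegenbauerInterval 0 d, ‖gegenbauerShift lam (Real.cosh t)
          (fun y => ∫ s, modifiedWeight lam α y s • g s ∂(gegenbauerMeasure lam))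
            (Real.cosh x) - c‖ₑ ∂(gegenbauerMeasure lam) ≤
          C * (∫⁻ t, ‖g t‖ₑ ^ p ∂(gegenbauerMeasure lam)) ^ (1 / p) *
            gegenbauerMeasure lam (gegenbauerInterval 0 d) := by
  have := isFiniteMeasure_angleMeasure hlam
  have hM := measure_lt_top (angleMeasure lam) univ
  obtain ⟨C₁, hC₁, hle₁⟩ := exists_enorm_integral_sub_le hlam hα' hpq hβq
  obtain ⟨C₂, hC₂, hle₂⟩ := setLIntegral_shiftConv_kernelGap_le hlam hα hα' hpα hpq
  set C₀ := ‖shiftConst lam‖ₑ with hC₀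
  have hC₀t : C₀ < ⊤ := enorm_lt_top
  refine ⟨C₀ * (C₀ * (C₂ + C₁ * angleMeasure lam univ)), ENNReal.mul_lt_top hC₀t
    (ENNReal.mul_lt_top hC₀t (ENNReal.add_lt_top.2 ⟨hC₂, ENNReal.mul_lt_top hC₁ hM⟩)), ?_⟩
  intro g hg hfin d hd x hx
  have hh : Measurable fun t => ‖g t‖ₑ := hg.measurable.enorm
  obtain ⟨a, ha⟩ := hle₁ g hg hfin d hd x hx
  set F : ℝ → ℂ := fun y => ∫ s, modifiedWeight lam α y s • g s ∂(gegenbauerMeasure lam) with hF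
  have hFm : StronglyMeasurable F := stronglyMeasurable_integral_modifiedWeight lam α hg
  set N := (∫⁻ t, ‖g t‖ₑ ^ p ∂(gegenbauerMeasure lam)) ^ (1 / p) with hN
  set E := shiftConv lam (kernelGap lam α (min d 1)) (fun t => ‖g t‖ₑ) with hE
  have hEm : Measurable E := measurable_shiftConv lam (measurable_kernelGap lam α _) hh
  have hmH : MeasurableSet (gegenbauerInterval 0 d) :=
    measurableSet_Ioo.inter measurableSet_Ici
  refine ⟨shiftConst lam • (angleMeasure lam).real univ • a, ?_⟩
  -- For almost all t and φ the shifted point avoids the null set where the pointwise comparison is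
  -- unavailable.
  have hae := ae_ae_shiftPoint lam
    (measurableSet_lt (measurable_shiftConv lam (measurable_kernelGap lam α 1) hh)
      measurable_const)
    (ae_shiftConv_kernelGap_lt_top hlam hα hα' hpq one_pos hh hfin) hx
  calc _ ≤ ∫⁻ t in gegenbauerInterval 0 d, C₀ * ∫⁻ φ,
          ‖F (shiftPoint (Real.cosh x) (Real.cosh t) φ) - a‖ₑ ∂(angleMeasure lam)
            ∂(gegenbauerMeasure lam) :=
        lintegral_mono fun t => enorm_gegenbauerShift_sub_le hlam hFm _ _ a
    _ ≤ ∫⁻ t in gegenbauerInterval 0 d, C₀ * (C₀ * (∫⁻ φ,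
          E (shiftPoint (Real.cosh x) (Real.cosh t) φ) ∂(angleMeasure lam) +
            C₁ * N * angleMeasure lam univ)) ∂(gegenbauerMeasure lam) := by
        refine lintegral_mono_ae ?_
        filter_upwards [ae_restrict_of_ae hae, ae_restrict_mem hmH] with t ht htH
        rw [gegenbauerInterval_zero hd] at htH
        gcongr
        rw [← lintegral_const, ← lintegral_add_right _ measurable_const,
          ← lintegral_const_mul' _ _ hC₀t.ne]
        refine lintegral_mono_ae ?_
        filter_upwards [ht] with φ hφ
        obtain ⟨r, hr, hrx, hreq⟩ := exists_cosh_eq_shiftPoint hx htH.1 φ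
        rw [← hreq] at hφ ⊢
        exact ha r hr (hrx.trans htH.2.le) hφ
    _ = C₀ * (C₀ * (∫⁻ t in gegenbauerInterval 0 d, ∫⁻ φ,
          E (shiftPoint (Real.cosh x) (Real.cosh t) φ) ∂(angleMeasure lam)
            ∂(gegenbauerMeasure lam) + C₁ * N * angleMeasure lam univ *
              gegenbauerMeasure lam (gegenbauerInterval 0 d))) := by
        rw [lintegral_const_mul' _ _ hC₀t.ne, lintegral_const_mul' _ _ hC₀t.ne,
          lintegral_add_right _ measurable_const, setLIntegral_const]
    _ ≤ C₀ * (C₀ * (C₂ * N * gegenbauerMeasure lam (gegenbauerInterval 0 d) +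
          C₁ * N * angleMeasure lam univ *
              gegenbauerMeasure lam (gegenbauerInterval 0 d))) := by
        gcongr
        exact hle₂ d hd _ hh x hx
    _ = _ := by ring

theorem locallyIntegrableOn_integral_modifiedWeight {lam α p q : ℝ} (hlam : 0 < lam) (hα : 0 < α)
    (hα' : α < 2 * lam + 1) (hpq : p.HolderConjugate q)
    (hβq : (2 * lam + 1 - α) * q = 2 * lam + 1) {g : ℝ → ℂ} (hg : StronglyMeasurable g)
    (hfin : ∫⁻ t, ‖g t‖ₑ ^ p ∂(gegenbauerMeasure lam) < ⊤) :
    LocallyIntegrableOn (fun r => ∫ s, modifiedWeight lam α (Real.cosh r) s • g s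
      ∂(gegenbauerMeasure lam)) (Ici 0) (gegenbauerMeasure lam) := by
  intro x hx
  have hx0 : (0 : ℝ) ≤ x := hx
  have hd : 0 < x + 1 := by linarith
  refine ⟨gegenbauerInterval 0 (x + 1), ?_, ?_⟩
  · rw [gegenbauerInterval, inter_comm]
    exact inter_mem_nhdsWithin _ (Ioo_mem_nhds (by linarith) (by linarith))
  have hh : Measurable fun t => ‖g t‖ₑ := hg.measurable.enorm
  obtain ⟨C, hC, hle⟩ := exists_enorm_integral_sub_le hlam hα' hpq hβq
  -- Centre 0 and radius x + 1 cover a neighbourhood of x, so local integrability follows from the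
  -- same comparison with a constant.
  obtain ⟨a, ha⟩ := hle g hg hfin (x + 1) hd 0 le_rfl
  have hmH : MeasurableSet (gegenbauerInterval 0 (x + 1)) :=
    measurableSet_Ioo.inter measurableSet_Ici
  have hμ := gegenbauerMeasure_interval_lt_top hlam hd
  have hFm := (stronglyMeasurable_integral_modifiedWeight lam α hg).comp_measurable
    Real.measurable_cosh
  have hNt : (∫⁻ t, ‖g t‖ₑ ^ p ∂(gegenbauerMeasure lam)) ^ (1 / p) < ⊤ :=
    ENNReal.rpow_lt_top_of_nonneg (by have := hpq.pos; positivity) hfin.ne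
  set N := (∫⁻ t, ‖g t‖ₑ ^ p ∂(gegenbauerMeasure lam)) ^ (1 / p) with hN
  set E := shiftConv lam (kernelGap lam α (min (x + 1) 1)) (fun t => ‖g t‖ₑ) with hE
  have hEfin : ∫⁻ r, E (Real.cosh r) ^ p ∂(gegenbauerMeasure lam) < ⊤ :=
    lintegral_shiftConv_kernelGap_lt_top hlam hα hα' hpq (lt_min hd one_pos) hh hfin
  have hEp : ∀ e : ENNReal, e ≤ 1 + e ^ p := by
    intro e
    rcases le_total e 1 with h | h
    · exact h.trans le_self_add
    · exact (ENNReal.le_rpow_self_of_one_le h hpq.lt.le).trans le_add_self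
  refine ⟨hFm.aestronglyMeasurable, ?_⟩
  rw [hasFiniteIntegral_iff_enorm]
  calc _ ≤ ∫⁻ t in gegenbauerInterval 0 (x + 1), (‖shiftConst lam‖ₑ *
          ((1 + E (Real.cosh t) ^ p) + C * N) + ‖a‖ₑ) ∂(gegenbauerMeasure lam) := by
        refine lintegral_mono_ae ?_
        filter_upwards [ae_restrict_of_ae
          (ae_shiftConv_kernelGap_lt_top hlam hα hα' hpq one_pos hh hfin),
          ae_restrict_mem hmH] with t ht htH
        rw [gegenbauerInterval_zero hd] at htH
        refine (le_trans (le_of_eq ?_) (enorm_add_le _ a)).trans (add_le_add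
          ((ha t htH.1 (by rw [sub_zero, abs_of_nonneg htH.1]; exact htH.2.le) ht).trans ?_) le_rfl)
        · rw [sub_add_cancel]
        · gcongr
          exact hEp _
    _ = ‖shiftConst lam‖ₑ * (1 * gegenbauerMeasure lam (gegenbauerInterval 0 (x + 1)) +
          ∫⁻ t in gegenbauerInterval 0 (x + 1), E (Real.cosh t) ^ p ∂(gegenbauerMeasure lam) +
            C * N * gegenbauerMeasure lam (gegenbauerInterval 0 (x + 1))) +
          ‖a‖ₑ * gegenbauerMeasure lam (gegenbauerInterval 0 (x + 1)) := by
        rw [lintegral_add_right _ measurable_const, lintegral_const_mul' _ _ enorm_ne_top,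
          lintegral_add_right _ measurable_const, lintegral_add_left measurable_const]
        simp only [setLIntegral_const]
    _ < ⊤ := by
        have h1 := (setLIntegral_le_lintegral (gegenbauerInterval 0 (x + 1))
          (fun r => E (Real.cosh r) ^ p) (μ := gegenbauerMeasure lam)).trans_lt hEfin
        refine ENNReal.add_lt_top.2 ⟨ENNReal.mul_lt_top enorm_lt_top (ENNReal.add_lt_top.2
          ⟨ENNReal.add_lt_top.2 ⟨ENNReal.mul_lt_top ENNReal.one_lt_top hμ, h1⟩,
            ENNReal.mul_lt_top (ENNReal.mul_lt_top hC hNt) hμ⟩),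
          ENNReal.mul_lt_top enorm_lt_top hμ⟩

/-! ### The theorem -/

theorem modifiedRieszGegenbauerIntegrand_ae_eq (lam α : ℝ) {f g : ℝ → ℂ}
    (hfg : (fun t => f (Real.cosh t)) =ᵐ[gegenbauerMeasure lam] g) (y : ℝ) :
    modifiedRieszGegenbauerIntegrand lam α f y =ᵐ[gegenbauerMeasure lam]
      fun t => modifiedWeight lam α y t • g t := by
  filter_upwards [hfg] with t ht
  rw [modifiedRieszGegenbauerIntegrand, modifiedWeight, ht]

theorem theorem4 (lam α p : ℝ) (hlam : 0 < lam) (hα : 0 < α) (hα' : α < 2 * lam + 1)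
    (hp : p * α = 2 * lam + 1) :
    ∃ c : ℝ, 0 < c ∧ ∀ f : ℝ → ℂ,
      MemLp (fun t => f (Real.cosh t)) (ENNReal.ofReal p) (gegenbauerMeasure lam) →
        (∀ᵐ x ∂(gegenbauerMeasure lam),
          Integrable (modifiedRieszGegenbauerIntegrand lam α f (Real.cosh x))
            (gegenbauerMeasure lam)) ∧
        MemGegenbauerBMO lam (modifiedRieszGegenbauer lam α f) ∧
        gegenbauerBMONorm lam (modifiedRieszGegenbauer lam α f) ≤
          ENNReal.ofReal c *
            eLpNorm (fun t => f (Real.cosh t)) (ENNReal.ofReal p) (gegenbauerMeasure lam) := by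
  -- From pα = 2λ+1 > α.
  have hp1 : 1 < p := by
    by_contra h
    have : p * α ≤ 1 * α := mul_le_mul_of_nonneg_right (not_lt.1 h) hα.le
    linarith
  have hp0 : 0 < p := by linarith
  have hpq := Real.HolderConjugate.conjExponent hp1
  set q := p.conjExponent with hq
  have hβq : (2 * lam + 1 - α) * q = 2 * lam + 1 := by
    have h1 : p - 1 ≠ 0 := by linarith
    rw [hq, Real.conjExponent, ← hp]
    field_simp
  obtain ⟨C, hC, hle⟩ := exists_setLIntegral_enorm_shift_sub_le hlam hα hα' hp hpq hβq
  have h2C : 2 * C < ⊤ := ENNReal.mul_lt_top ENNReal.ofNat_lt_top hC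
  -- The 2 comes from passing to the mean; the added 1 only makes the constant positive.
  refine ⟨(2 * C).toReal + 1, by positivity, fun f hf => ?_⟩
  -- Only t ↦ f(cosh t) enters, up to null sets, so it is replaced by a strongly measurable
  -- representative in t.
  obtain ⟨g, hg, hfg⟩ := hf.1
  have hfin' : eLpNorm g (ENNReal.ofReal p) (gegenbauerMeasure lam) < ⊤ := by
    rw [← eLpNorm_congr_ae hfg]; exact hf.2
  have hnorm : eLpNorm (fun t => f (Real.cosh t)) (ENNReal.ofReal p) (gegenbauerMeasure lam) =
      (∫⁻ t, ‖g t‖ₑ ^ p ∂(gegenbauerMeasure lam)) ^ (1 / p) := by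
    rw [eLpNorm_congr_ae hfg, eLpNorm_eq_lintegral_rpow_enorm_toReal (by simpa using hp0)
      ENNReal.ofReal_ne_top, ENNReal.toReal_ofReal hp0.le]
  have hfin : ∫⁻ t, ‖g t‖ₑ ^ p ∂(gegenbauerMeasure lam) < ⊤ := by
    have := hf.2
    rw [hnorm] at this
    exact (ENNReal.rpow_lt_top_iff_of_pos (by positivity)).1 this
  have hh : Measurable fun t => ‖g t‖ₑ := hg.measurable.enorm
  have hF : modifiedRieszGegenbauer lam α f =
      fun y => ∫ t, modifiedWeight lam α y t • g t ∂(gegenbauerMeasure lam) :=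
    funext fun y => integral_congr_ae (modifiedRieszGegenbauerIntegrand_ae_eq lam α hfg y)
  have hBMO : gegenbauerBMONorm lam (modifiedRieszGegenbauer lam α f) ≤
      ENNReal.ofReal ((2 * C).toReal + 1) *
        eLpNorm (fun t => f (Real.cosh t)) (ENNReal.ofReal p) (gegenbauerMeasure lam) := by
    have hCle : 2 * C ≤ ENNReal.ofReal ((2 * C).toReal + 1) := by
      rw [ENNReal.ofReal_add ENNReal.toReal_nonneg zero_le_one, ENNReal.ofReal_toReal h2C.ne]
      exact le_self_add
    refine iSup_le fun x => iSup_le fun hx => iSup_le fun d => iSup_le fun hd => ?_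
    obtain ⟨c, hc⟩ := hle g hg hfin d hd x hx
    rw [← hF] at hc
    have hFm : StronglyMeasurable (modifiedRieszGegenbauer lam α f) := by
      rw [hF]; exact stronglyMeasurable_integral_modifiedWeight lam α hg
    have hum : StronglyMeasurable fun t => gegenbauerShift lam (Real.cosh t)
        (modifiedRieszGegenbauer lam α f) (Real.cosh x) :=
      stronglyMeasurable_gegenbauerShift_right lam hFm _
    have hμt := gegenbauerMeasure_interval_lt_top hlam hd
    have hfm : IsFiniteMeasure ((gegenbauerMeasure lam).restrict (gegenbauerInterval 0 d)) :=
      ⟨by rw [Measure.restrict_apply_univ]; exact hμt⟩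
    have hosc := lintegral_enorm_sub_average_le (c := c) hum.aestronglyMeasurable
      (κ := (gegenbauerMeasure lam).restrict (gegenbauerInterval 0 d))
    set μH := gegenbauerMeasure lam (gegenbauerInterval 0 d) with hμH
    set N := (∫⁻ t, ‖g t‖ₑ ^ p ∂(gegenbauerMeasure lam)) ^ (1 / p) with hN
    calc _ ≤ μH⁻¹ * (2 * (C * N * μH)) := by
          gcongr
          exact hosc.trans (by gcongr)
      _ = 2 * C * N * (μH⁻¹ * μH) := by ring
      _ ≤ 2 * C * N * 1 := by gcongr; exact ENNReal.inv_mul_le_one _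
      _ ≤ _ := by rw [mul_one, hnorm]; gcongr
  refine ⟨?_, ⟨?_, hBMO.trans_lt (ENNReal.mul_lt_top ENNReal.ofReal_lt_top hf.2)⟩, hBMO⟩
  · filter_upwards [ae_gegenbauerMeasure_pos lam,
      ae_shiftConv_kernelGap_lt_top hlam hα hα' hpq one_pos hh hfin] with x hx hx'
    exact (integrable_modifiedWeight_smul hlam hpq hβq hg hfin hx.le hx').congr
      (modifiedRieszGegenbauerIntegrand_ae_eq lam α hfg _).symm
  · rw [hF]
    exact locallyIntegrableOn_integral_modifiedWeight hlam hα hα' hpq hβq hg hfin
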